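/- Let $\mathbf A\in\mathbb R^{s\times s}$, $\mathbf b\in\mathbb R^s$ ($s\ge 1$) be the coefficients of a Runge–Kutta method, put $\mathbf q(z)=\mathbf b^T(I-z\mathbf A)^{-1}$ and $r(z)=1+z\,\mathbf q(z)\mathbb 1$ with $\mathbb 1=(1,\dots,1)^T$, and assume that the method has order at least one ($\sum_i b_i=1$), is $A$-stable ($I-z\mathbf A$ is invertible and $|r(z)|\le 1$ whenever $\operatorname{Re}z\le 0$), that $|r(iy)|<1$ for all real $y\ne0$, that $\mathbf A$ is invertible, and that the method is stiffly accurate ($\mathbf b^T\mathbf A^{-1}=(0,\dots,0,1)$). Fix a norm $\|\cdot\|$ on $\mathbb C^s$. Let $h>0$, $x\in\mathbb R$, $d=|x|$, $t_n=nh$. Let $$K(z,x)=\frac{1}{2\sqrt{z/i}}\exp\bigl(-d\sqrt{z/i}\bigr),\qquad \sqrt{z/i}=e^{-i\pi/4}\sqrt z,$$ with the principal branch of $\sqrt z$ on $\mathbb C\setminus(-\infty,0]$, be the transfer function of the one-dimensional Schrödinger kernel, and let $$G(\lambda,x)=K(\lambda e^{-i\pi},x)-K(\lambda e^{i\pi},x)=\frac{i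 e^{i\pi/4}}{\sqrt\lambda}\cosh\bigl(d e^{i\pi/4}\sqrt\lambda\bigr),\qquad \lambda>0,$$ be its jump across the cut (value from below minus value from above). With $\boldsymbol\Delta(\zeta)=\bigl(\mathbf A+\tfrac{\zeta}{1-\zeta}\mathbb 1\mathbf b^T\bigr)^{-1}$, let $\boldsymbol\omega_n(x)$ be the last row of $\mathbf W_n$ and $\mathbf e_n(z)$ the last row of $\mathbf E_n(z)$, where, for $\zeta$ near $0$, $$\sum_{n\ge0}\mathbf W_n\zeta^n=K\!\left(\frac{\boldsymbol\Delta(\zeta)}{h},x\right),\qquad \sum_{n\ge0}\mathbf E_n(z)\zeta^n=(\boldsymbol\Delta(\zeta)-zI)^{-1}$$ (matrix function in the usual sense). For $\xi>0$ put $$\mathbf I_n=\frac{h}{2\pi i}\int_0^\xi G(\lambda,x)\,\mathbf e_n(-h\lambda)\,d\lambda .$$ Then, for all $h>0$, $\xi>0$, $x\in\mathbb R$ and $n\ge0$, the integral defining $\mathbf I_n$ and the two integrals below converge, and $$\|\boldsymbol\omega_n(x)-\mathbf I_n\|\le \frac{h}{4\pi}\int_0^\infty\|\mathbf e_n(h(-\xi+iy))\|\,e^{-d\operatorname{Re}(e^{-i\pi/4}\sqrt{-\xi+iy})}(\xi^2+y^2)^{-1/4}dy+\frac{h}{4\pi}\int_0^\infty\|\mathbf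 e_n(h(-\xi-iy))\|\,e^{-d\operatorname{Re}(e^{-i\pi/4}\sqrt{-\xi-iy})}(\xi^2+y^2)^{-1/4}dy .$$ Moreover there is a constant $C_A>0$, depending only on the method and the norm, with $$\max\bigl(|r(z)|,\|\mathbf q(z)\|\bigr)\le C_A|z|^{-1}\qquad\text{for all } z\neq0 \text{ with }\operatorname{Re}z\le0,$$ and for every such constant, and all $h,\xi,x,n$ as above, $$\|\boldsymbol\omega_n(x)-\mathbf I_n\|\le C_A\,\frac{\sqrt{2\pi/\xi}}{2\,\Gamma(3/4)^2}\,\cosh\bigl(d\sqrt{\xi/2}\bigr)\,e^{-\gamma(h\xi)\,t_n\,\xi},$$ where $\gamma(\eta)=\inf\{\log|r(z)|/\operatorname{Re}z:\ -\eta\le\operatorname{Re}z<0,\ r(z)\ne0\}$ for $\eta>0$. -/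

import Mathlib

open Complex MeasureTheory Set

noncomputable section

/-- The coefficients `A`, `b` of an `s`-stage Runge-Kutta method, `s = m + 1`.  (The nodes `c` of
the Butcher tableau only say where the data are sampled; they do not enter the weights.) -/
structure RungeKutta (m : ℕ) where
  A : Matrix (Fin (m + 1)) (Fin (m + 1)) ℝ
  b : Fin (m + 1) → ℝ

namespace RungeKutta

variable {m : ℕ} (M : RungeKutta m)

/-- The coefficient matrix with complex entries. -/
def Ac : Matrix (Fin (m + 1)) (Fin (m + 1)) ℂ := M.A.map (fun t : ℝ => (t : ℂ))

/-- The vector `b` with complex entries. -/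
def bc : Fin (m + 1) → ℂ := fun i => (M.b i : ℂ)

/-- The row vector `q(z) = bᵀ (I - z A)⁻¹`. -/
def q (z : ℂ) : Fin (m + 1) → ℂ := Matrix.vecMul M.bc (1 - z • M.Ac)⁻¹

/-- The stability function `r(z) = 1 + z bᵀ (I - z A)⁻¹ 𝟙`. -/
def r (z : ℂ) : ℂ := 1 + z * (M.q z ⬝ᵥ (fun _ => 1))

/-- The standing assumptions on the method. -/
structure Admissible : Prop where
  /-- Order at least one. -/
  order_one : ∑ i, M.b i = 1
  /-- A-stability, first part: the stage equations are solvable for every `z` in the closed left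
  half-plane, so that `r(z)` and `q(z)` are defined there. -/
  nonsingular : ∀ z : ℂ, z.re ≤ 0 → IsUnit (1 - z • M.Ac)
  /-- A-stability, second part. -/
  norm_r_le : ∀ z : ℂ, z.re ≤ 0 → ‖M.r z‖ ≤ 1
  norm_r_lt : ∀ y : ℝ, y ≠ 0 → ‖M.r (y * I)‖ < 1
  invertible : IsUnit M.A
  /-- Stiff accuracy, `bᵀ A⁻¹ = (0, …, 0, 1)`. -/
  stiffly_accurate : Matrix.vecMul M.b M.A⁻¹ = Pi.single (Fin.last m) 1

/-- The symbol `Δ(ζ) = (A + ζ / (1 - ζ) 𝟙 bᵀ)⁻¹`. -/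
def symbol (ζ : ℂ) : Matrix (Fin (m + 1)) (Fin (m + 1)) ℂ :=
  (M.Ac + (ζ / (1 - ζ)) • Matrix.vecMulVec (fun _ => 1) M.bc)⁻¹

/-- `γ(ξ) = inf { log |r(z)| / Re z : -ξ ≤ Re z ≤ 0 }`.  Points with `Re z = 0`, where the quotient
is not a finite number, and zeros of `r`, where it is `+∞`, do not contribute to the infimum. -/
def gammaInf (ξ : ℝ) : ℝ :=
  sInf {t : ℝ | ∃ z : ℂ, -ξ ≤ z.re ∧ z.re < 0 ∧ M.r z ≠ 0 ∧ t = Real.log ‖M.r z‖ / z.re}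

/-- `C > 0` satisfies `max (|r(z)|, ‖q(z)‖) ≤ C |z|⁻¹` for all `Re z ≤ 0`
(written without division; at `z = 0` there is nothing to check). -/
def IsDecayConstant (N : Seminorm ℂ (Fin (m + 1) → ℂ)) (C : ℝ) : Prop :=
  0 < C ∧ ∀ z : ℂ, z.re ≤ 0 → ‖z‖ * max ‖M.r z‖ (N (M.q z)) ≤ C

end RungeKutta

/-- The `n`-th coefficient of the power series expansion about `0` of a matrix-valued function. -/
def powerCoeff {m : ℕ} (F : ℂ → Matrix (Fin (m + 1)) (Fin (m + 1)) ℂ) (n : ℕ) :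
    Matrix (Fin (m + 1)) (Fin (m + 1)) ℂ :=
  fun i j => iteratedDeriv n (fun ζ => F ζ i j) 0 / (n.factorial : ℂ)

/-- `p` interpolates `f` on the spectrum of `B`: at each eigenvalue `μ`, where `f` has to be
analytic, `p` and `f` have the same derivatives of all orders below the algebraic multiplicity. -/
def InterpolatesOnSpectrum {m : ℕ} (f : ℂ → ℂ) (B : Matrix (Fin (m + 1)) (Fin (m + 1)) ℂ)
    (p : Polynomial ℂ) : Prop :=
  ∀ μ : ℂ, B.charpoly.IsRoot μ → AnalyticAt ℂ f μ ∧
    ∀ j < B.charpoly.rootMultiplicity μ,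
      (Polynomial.derivative^[j] p).eval μ = iteratedDeriv j f μ

open scoped Classical in
/-- The matrix function `f(B) = p(B)`, where `p` is any polynomial that interpolates `f` on the
spectrum of `B` (by the Cayley-Hamilton theorem the choice of `p` does not matter). -/
def matrixFunction {m : ℕ} (f : ℂ → ℂ) (B : Matrix (Fin (m + 1)) (Fin (m + 1)) ℂ) :
    Matrix (Fin (m + 1)) (Fin (m + 1)) ℂ :=
  if H : ∃ p : Polynomial ℂ, InterpolatesOnSpectrum f B p then Polynomial.aeval B H.choose else 0

/-- `exp (-d u) / (2 u)` with `u = e^{-iπ/4} w`: the one-dimensional transfer function in terms of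
the value `w` of `√z`. -/
def transferOfSqrt (d : ℝ) (w : ℂ) : ℂ :=
  Complex.exp (-(d * (Complex.exp (-(Real.pi * I) / 4) * w))) /
    (2 * (Complex.exp (-(Real.pi * I) / 4) * w))

/-- The transfer function `K(z, x) = exp (-|x| √(z/i)) / (2 √(z/i))`, where
`√(z/i) = e^{-iπ/4} √z` with the principal branch of `√z`, cut along `(-∞, 0]`. -/
def transferFn (x : ℝ) (z : ℂ) : ℂ := transferOfSqrt |x| (z ^ (1 / 2 : ℂ))

/-- `G(λ, x) = K(λ e^{-iπ}, x) - K(λ e^{iπ}, x)`, the jump of `K` across the cut at `-λ`: the values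
of `√z` on the lower and on the upper side are `√λ e^{-iπ/2}` and `√λ e^{iπ/2}`. -/
def jumpFn (x : ℝ) (l : ℝ) : ℂ :=
  transferOfSqrt |x| (Real.sqrt l * Complex.exp (-(Real.pi * I) / 2)) -
    transferOfSqrt |x| (Real.sqrt l * Complex.exp (Real.pi * I / 2))

namespace RungeKutta

variable {m : ℕ} (M : RungeKutta m)

/-- `e_n(z)`, the last row of `E_n(z)`, where `∑ E_n(z) ζⁿ = (Δ(ζ) - z I)⁻¹`. -/
def eVec (n : ℕ) (z : ℂ) : Fin (m + 1) → ℂ :=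
  powerCoeff (fun ζ => (M.symbol ζ - z • (1 : Matrix (Fin (m + 1)) (Fin (m + 1)) ℂ))⁻¹) n
    (Fin.last m)

/-- `ω_n(x)`, the last row of the convolution quadrature weight `W_n`, where
`∑ W_n ζⁿ = K(Δ(ζ) / h, x)`. -/
def weight (h x : ℝ) (n : ℕ) : Fin (m + 1) → ℂ :=
  powerCoeff (fun ζ => matrixFunction (transferFn x) ((h : ℂ)⁻¹ • M.symbol ζ)) n (Fin.last m)

/-- `I_n = h / (2πi) ∫₀^ξ G(λ, x) e_n(-hλ) dλ`. -/
def truncated (h ξ x : ℝ) (n : ℕ) : Fin (m + 1) → ℂ :=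
  ((h : ℂ) / (2 * Real.pi * I)) •
    ∫ l in (0 : ℝ)..ξ, jumpFn x l • M.eVec n (-((h : ℂ) * (l : ℂ)))

/-- `‖e_n(h z)‖ e^{-d Re (e^{-iπ/4} √z)} (ξ² + y²)^{-1/4}` at `z = -ξ + i σ y`, with `d = |x|`;
`σ = 1` and `σ = -1` give the integrands on the upper and the lower vertical half-line. -/
def lineIntegrand (N : Seminorm ℂ (Fin (m + 1) → ℂ)) (h ξ x : ℝ) (n : ℕ) (σ y : ℝ) : ℝ :=
  N (M.eVec n ((h : ℂ) * (-(ξ : ℂ) + I * σ * y))) *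
    Real.exp (-|x| * (Complex.exp (-(Real.pi * I) / 4) *
      (-(ξ : ℂ) + I * σ * y) ^ (1 / 2 : ℂ)).re) *
    (ξ ^ 2 + y ^ 2) ^ (-(1 / 4) : ℝ)

end RungeKutta

end

/-! The weights are identified by writing the transfer function `K` as a superposition of Cauchy
kernels `1 / (w - z)`, for which everything is explicit. For `Re z > 0`, Cauchy's formula is
deformed to the line `Re w = -ξ` and the two sides of the cut between `-ξ` and `0`, so `K(z)` is the
sum of three Cauchy transforms `∫ φ / (w - z)` with `w` in the closed left half-plane
(`transferFn_eq_integral`). The spectrum of `Δ(ζ)/h` lies in the open right half-plane for `|ζ| <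
1`, so `K(Δ(ζ)/h)` is the corresponding sum of integrals of resolvents
(`CauchyDatum.exists_interpolant`).

Stiff accuracy makes `Δ(ζ)` a rank-one perturbation of `A⁻¹`, and the last row of `(Δ(ζ) - z)⁻¹` is
`(1 - ζ r(z))⁻¹ q(z)`. Its geometric series gives `e_n(z) = r(z)ⁿ q(z)`, and summing under the
integral gives `ω_n` as three contour integrals of `e_n(h w)` (`weight_apply`). The cut integral is
exactly `I_n`; the difference consists of the two half-lines, and taking norms gives the first
estimate.

For the second estimate, on the line `Re w = -ξ` one has `|r(hw)|ⁿ ≤ exp(-γ(hξ) t_n ξ)` by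
definition of `γ`, and `‖q(hw)‖ ≤ C / (h|w|)`. The real part of `√(w/i)` is at least `√(ξ/2)` on the
upper half-line and at least `-√(ξ/2)` on the lower one, so the two exponentials add up to a `cosh`.
What remains is `∫ (ξ² + y²)^(-3/4) dy`, for which a crude bound is enough. -/

section

open Filter Topology

/-! ### Cauchy transforms of densities in the left half-plane. -/

section CauchyTransform

/-- A density `φ` along a curve `w` in the closed left half-plane whose Cauchy transform converges
absolutely on the open right half-plane. -/
structure CauchyDatum {α : Type*} [MeasurableSpace α] (μ : Measure α) (w φ : α → ℂ) : Prop where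
  measurable_curve : AEStronglyMeasurable w μ
  measurable_density : AEStronglyMeasurable φ μ
  re_nonpos : ∀ᵐ a ∂μ, (w a).re ≤ 0
  integrable : Integrable (fun a => ‖φ a‖ / (1 + ‖w a‖)) μ

/-- Away from `z`, `|w - z|` is comparable to `1 + |w|`; this turns the integrability of `|φ| / (1 +
|w|)` into convergence of the Cauchy transform. -/
theorem one_add_norm_le_mul_norm_sub {w z : ℂ} {δ : ℝ} (hδ : 0 < δ) (h : δ ≤ ‖w - z‖) :
    1 + ‖w‖ ≤ ((1 + ‖z‖) / δ + 1) * ‖w - z‖ := by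
  have h1 : ‖w‖ ≤ ‖w - z‖ + ‖z‖ := by simpa using norm_add_le (w - z) z
  have h2 : 1 + ‖z‖ ≤ (1 + ‖z‖) / δ * ‖w - z‖ := by
    rw [div_mul_eq_mul_div, le_div_iff₀ hδ]
    gcongr
  linarith

theorem le_norm_sub_of_re {w z : ℂ} {δ : ℝ} (hw : w.re ≤ 0) (hz : δ ≤ z.re) : δ ≤ ‖w - z‖ := by
  have := abs_re_le_norm (w - z)
  rw [sub_re, abs_le] at this
  linarith

theorem norm_inv_sub_le {w z : ℂ} {δ : ℝ} (hδ : 0 < δ) (hw : w.re ≤ 0) (hz : δ ≤ z.re) :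
    ‖(w - z)⁻¹‖ ≤ ((1 + ‖z‖) / δ + 1) / (1 + ‖w‖) := by
  have h := le_norm_sub_of_re hw hz
  rw [norm_inv, inv_eq_one_div, div_le_div_iff₀ (hδ.trans_le h) (by positivity), one_mul]
  exact one_add_norm_le_mul_norm_sub hδ h

namespace CauchyDatum

variable {α : Type*} [MeasurableSpace α] {μ : Measure α} {w φ : α → ℂ}

theorem integrable_mul (H : CauchyDatum μ w φ) {g : α → ℂ} (hg : AEStronglyMeasurable g μ) (C : ℝ)
    (h : ∀ a, (w a).re ≤ 0 → ‖g a‖ ≤ C / (1 + ‖w a‖)) : Integrable (fun a => φ a * g a) μ := by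
  refine (H.integrable.const_mul C).mono' (H.measurable_density.mul hg) ?_
  filter_upwards [H.re_nonpos] with a ha
  calc ‖φ a * g a‖ = ‖φ a‖ * ‖g a‖ := norm_mul _ _
    _ ≤ ‖φ a‖ * (C / (1 + ‖w a‖)) := by gcongr; exact h a ha
    _ = _ := by ring

theorem aestronglyMeasurable_comp (H : CauchyDatum μ w φ) {g : ℂ → ℂ} (hg : Measurable g) :
    AEStronglyMeasurable (fun a => g (w a)) μ :=
  (hg.comp_aemeasurable H.measurable_curve.aemeasurable).aestronglyMeasurable

theorem mul_comp (H : CauchyDatum μ w φ) {g : ℂ → ℂ} (hg : Measurable g) (C : ℝ)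
    (h : ∀ z : ℂ, z.re ≤ 0 → ‖g z‖ ≤ C) : CauchyDatum μ w (fun a => φ a * g (w a)) where
  measurable_curve := H.measurable_curve
  measurable_density := H.measurable_density.mul (H.aestronglyMeasurable_comp hg)
  re_nonpos := H.re_nonpos
  integrable := by
    have hm : AEStronglyMeasurable (fun a => ‖φ a * g (w a)‖ / (1 + ‖w a‖)) μ :=
      ((H.measurable_density.mul (H.aestronglyMeasurable_comp hg)).norm.aemeasurable.div
        (H.measurable_curve.norm.aemeasurable.const_add 1)).aestronglyMeasurable
    refine (H.integrable.const_mul C).mono' hm ?_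
    filter_upwards [H.re_nonpos] with a ha
    rw [Real.norm_of_nonneg (by positivity), norm_mul]
    calc ‖φ a‖ * ‖g (w a)‖ / (1 + ‖w a‖) ≤ ‖φ a‖ * C / (1 + ‖w a‖) := by gcongr; exact h _ ha
      _ = _ := by ring

theorem integrable_div (H : CauchyDatum μ w φ) {z : ℂ} (hz : 0 < z.re) :
    Integrable (fun a => φ a / (w a - z)) μ := by
  simp_rw [div_eq_mul_inv]
  exact H.integrable_mul (g := fun a => (w a - z)⁻¹)
    (H.aestronglyMeasurable_comp (g := fun x => (x - z)⁻¹) (by fun_prop)) _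
    fun a ha => norm_inv_sub_le hz ha le_rfl

theorem differentiableOn (H : CauchyDatum μ w φ) :
    DifferentiableOn ℂ (fun z => ∫ a, φ a / (w a - z) ∂μ) {z | 0 < z.re} := by
  intro z₀ hz₀
  have hz₀ : 0 < z₀.re := hz₀
  set δ := z₀.re / 2 with hδ
  have hδ0 : 0 < δ := by positivity
  have hre : ∀ z ∈ Metric.ball z₀ δ, δ ≤ z.re := by
    intro z hz
    have h1 := (abs_re_le_norm (z - z₀)).trans (mem_ball_iff_norm.1 hz).le
    rw [sub_re, abs_le] at h1
    linarith
  have hno : ∀ z ∈ Metric.ball z₀ δ, ‖z‖ ≤ ‖z₀‖ + δ := by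
    intro z hz
    have h1 := (norm_add_le (z - z₀) z₀).trans
      (add_le_add_left (mem_ball_iff_norm.1 hz).le _)
    rw [sub_add_cancel] at h1
    linarith
  refine DifferentiableAt.differentiableWithinAt ?_
  refine (hasDerivAt_integral_of_dominated_loc_of_deriv_le (F := fun z a => φ a / (w a - z))
    (F' := fun z a => φ a / (w a - z) ^ 2)
    (bound := fun a => ((1 + (‖z₀‖ + δ)) / δ + 1) / δ * (‖φ a‖ / (1 + ‖w a‖)))
    (Metric.ball_mem_nhds z₀ hδ0) ?_ (H.integrable_div hz₀) ?_ ?_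
    (H.integrable.const_mul _) ?_).2.differentiableAt
  · filter_upwards [Metric.ball_mem_nhds z₀ hδ0] with z hz
    exact (H.integrable_div (hδ0.trans_le (hre z hz))).aestronglyMeasurable
  · simp_rw [div_eq_mul_inv]
    exact H.measurable_density.mul
      (H.aestronglyMeasurable_comp (g := fun x => ((x - z₀) ^ 2)⁻¹) (by fun_prop))
  · filter_upwards [H.re_nonpos] with a ha z hz
    have h1 := norm_inv_sub_le hδ0 ha (hre z hz)
    have h2 := le_norm_sub_of_re ha (hre z hz)
    have h3 : ‖(w a - z)⁻¹‖ ≤ 1 / δ := by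
      rw [norm_inv, inv_eq_one_div]
      exact one_div_le_one_div_of_le hδ0 h2
    calc ‖φ a / (w a - z) ^ 2‖ = ‖φ a‖ * (‖(w a - z)⁻¹‖ * ‖(w a - z)⁻¹‖) := by
          rw [norm_div, norm_pow, norm_inv]; field_simp
      _ ≤ ‖φ a‖ * (((1 + ‖z‖) / δ + 1) / (1 + ‖w a‖) * (1 / δ)) := by gcongr
      _ ≤ ‖φ a‖ * (((1 + (‖z₀‖ + δ)) / δ + 1) / (1 + ‖w a‖) * (1 / δ)) := by
          gcongr; exact hno z hz
      _ = _ := by ring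
  · filter_upwards [H.re_nonpos] with a ha z hz
    have h2 : w a - z ≠ 0 := norm_pos_iff.1 (hδ0.trans_le (le_norm_sub_of_re ha (hre z hz)))
    have := ((hasDerivAt_id z).const_sub (w a)).inv h2 |>.const_mul (φ a)
    simpa [div_eq_mul_inv] using this

theorem analyticAt (H : CauchyDatum μ w φ) {z : ℂ} (hz : 0 < z.re) :
    AnalyticAt ℂ (fun z => ∫ a, φ a / (w a - z) ∂μ) z :=
  H.differentiableOn.analyticAt ((isOpen_lt continuous_const continuous_re).mem_nhds hz)

end CauchyDatum

end CauchyTransform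

/-! ### Matrix functions of Cauchy transforms, by Hermite interpolation. -/

section Interpolation

open Polynomial

theorem exists_mul_pow_le_norm_prod (S : Multiset ℂ) (hS : ∀ μ ∈ S, 0 < μ.re) :
    ∃ c : ℝ, 0 < c ∧ ∀ w : ℂ, w.re ≤ 0 →
      c * (1 + ‖w‖) ^ S.card ≤ ‖(S.map (fun μ => w - μ)).prod‖ := by
  induction S using Multiset.induction_on with
  | empty => exact ⟨1, one_pos, by simp⟩
  | cons μ S ih =>
    obtain ⟨c, hc, h⟩ := ih fun ν hν => hS ν (Multiset.mem_cons_of_mem hν)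
    have hμ := hS μ (Multiset.mem_cons_self μ S)
    have hk : 0 < (1 + ‖μ‖) / μ.re + 1 := by positivity
    refine ⟨c / ((1 + ‖μ‖) / μ.re + 1), by positivity, fun w hw => ?_⟩
    have h1 := one_add_norm_le_mul_norm_sub hμ (le_norm_sub_of_re hw (le_refl μ.re))
    rw [Multiset.map_cons, Multiset.prod_cons, norm_mul, Multiset.card_cons, pow_succ]
    calc _ = ((1 + ‖w‖) / ((1 + ‖μ‖) / μ.re + 1)) * (c * (1 + ‖w‖) ^ S.card) := by ring
      _ ≤ _ := by
        gcongr
        · rwa [div_le_iff₀' hk]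
        · exact h w hw

variable {m : ℕ} {B : Matrix (Fin (m + 1)) (Fin (m + 1)) ℂ}

theorem charpoly_natDegree_eq_succ (B : Matrix (Fin (m + 1)) (Fin (m + 1)) ℂ) :
    B.charpoly.natDegree = m + 1 := by
  rw [Matrix.charpoly_natDegree_eq_dim, Fintype.card_fin]

theorem exists_mul_pow_le_norm_charpoly (hB : ∀ μ, B.charpoly.IsRoot μ → 0 < μ.re) :
    ∃ c : ℝ, 0 < c ∧ ∀ w : ℂ, w.re ≤ 0 → c * (1 + ‖w‖) ^ (m + 1) ≤ ‖B.charpoly.eval w‖ := by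
  have hs := IsAlgClosed.splits B.charpoly
  obtain ⟨c, hc, h⟩ := exists_mul_pow_le_norm_prod B.charpoly.roots
    fun μ hμ => hB μ (isRoot_of_mem_roots hμ)
  refine ⟨c, hc, fun w hw => ?_⟩
  rw [hs.eval_eq_prod_roots_of_monic (Matrix.charpoly_monic B)]
  have := h w hw
  rwa [← hs.natDegree_eq_card_roots, charpoly_natDegree_eq_succ] at this

theorem eval_charpoly_ne_zero (hB : ∀ μ, B.charpoly.IsRoot μ → 0 < μ.re) {w : ℂ} (hw : w.re ≤ 0) :
    B.charpoly.eval w ≠ 0 := fun h => absurd (hB w h) (not_lt.2 hw)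

/-- All eigenvalues lie to the right of `w`, so each of the `m + 1` factors of the characteristic
polynomial is at least a multiple of `1 + |w|`, one more than the power `w ^ i` can use up. -/
theorem exists_norm_pow_div_charpoly_le (hB : ∀ μ, B.charpoly.IsRoot μ → 0 < μ.re) :
    ∃ C : ℝ, 0 < C ∧ ∀ w : ℂ, w.re ≤ 0 → ∀ i ≤ m,
      ‖w ^ i / B.charpoly.eval w‖ ≤ C / (1 + ‖w‖) := by
  obtain ⟨c, hc, h⟩ := exists_mul_pow_le_norm_charpoly hB
  refine ⟨1 / c, by positivity, fun w hw i hi => ?_⟩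
  have h0 : 0 < ‖B.charpoly.eval w‖ := norm_pos_iff.2 (eval_charpoly_ne_zero hB hw)
  rw [norm_div, norm_pow, div_le_div_iff₀ h0 (by positivity), div_mul_eq_mul_div, one_mul,
    le_div_iff₀ hc]
  refine le_trans ?_ (h w hw)
  have h1 : ‖w‖ ^ i ≤ (1 + ‖w‖) ^ m :=
    (pow_le_pow_left₀ (norm_nonneg _) (by linarith) i).trans
      (pow_le_pow_right₀ (by linarith [norm_nonneg w]) hi)
  calc ‖w‖ ^ i * (1 + ‖w‖) * c ≤ (1 + ‖w‖) ^ m * (1 + ‖w‖) * c := by gcongr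
    _ = _ := by ring

theorem X_sub_C_mul_divByMonic (p : ℂ[X]) (w : ℂ) :
    (X - C w) * (p /ₘ (X - C w)) = p - C (p.eval w) := by
  have := modByMonic_add_div p (X - C w)
  rw [modByMonic_X_sub_C_eq_C_eval] at this
  rw [eq_sub_iff_add_eq', this]

theorem natDegree_charpoly_divByMonic_lt (w : ℂ) :
    (B.charpoly /ₘ (X - C w)).natDegree < m + 1 := by
  rw [natDegree_divByMonic _ (monic_X_sub_C w), charpoly_natDegree_eq_succ, natDegree_X_sub_C]
  omega

/-- With `χ` the characteristic polynomial, substitute `B` in `(X - w) Q_w = χ - χ(w)` and use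
Cayley–Hamilton. -/
theorem resolvent_eq_aeval {w : ℂ} (hw : B.charpoly.eval w ≠ 0) :
    (w • (1 : Matrix (Fin (m + 1)) (Fin (m + 1)) ℂ) - B)⁻¹ =
      (B.charpoly.eval w)⁻¹ • aeval B (B.charpoly /ₘ (X - C w)) := by
  apply Matrix.inv_eq_right_inv
  have h := congrArg (aeval B) (X_sub_C_mul_divByMonic B.charpoly w)
  rw [map_mul, map_sub, map_sub, aeval_X, aeval_C, aeval_C, Matrix.aeval_self_charpoly, zero_sub,
    Algebra.algebraMap_eq_smul_one, Algebra.algebraMap_eq_smul_one] at h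
  rw [Matrix.mul_smul, ← neg_sub B, neg_mul, h, neg_neg, smul_smul, inv_mul_cancel₀ hw, one_smul]

namespace CauchyDatum

variable {α : Type*} [MeasurableSpace α] {μ : Measure α} {w φ : α → ℂ}

/-- `P = ∫ φ Q_w / χ(w)`, with `Q_w = (χ - χ(w)) / (X - w)`, is formed coefficientwise: the
coefficients of `Q_w` are polynomials in `w` of degree at most `m`. Stating it for every linear
functional `L` allows the same `P` to be tested by evaluation at a point and by an entry of `aeval
B`. -/
theorem exists_polynomial (H : CauchyDatum μ w φ) (hB : ∀ μ, B.charpoly.IsRoot μ → 0 < μ.re) :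
    ∃ P : ℂ[X], ∀ L : ℂ[X] →ₗ[ℂ] ℂ,
      Integrable (fun a => φ a * ((B.charpoly.eval (w a))⁻¹ * L (B.charpoly /ₘ (X - C (w a))))) μ ∧
      L P = ∫ a, φ a * ((B.charpoly.eval (w a))⁻¹ * L (B.charpoly /ₘ (X - C (w a)))) ∂μ := by
  obtain ⟨D, hD, hb⟩ := exists_norm_pow_div_charpoly_le hB
  have hint : ∀ k, Integrable (fun a => φ a * ((B.charpoly.eval (w a))⁻¹ *
      (B.charpoly /ₘ (X - C (w a))).coeff k)) μ := by
    intro k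
    simp_rw [coeff_divByMonic_X_sub_C, charpoly_natDegree_eq_succ]
    have h1 : ∀ i ∈ Finset.Icc (k + 1) (m + 1), Integrable (fun a => φ a *
        (w a ^ (i - (k + 1)) / B.charpoly.eval (w a)) * B.charpoly.coeff i) μ := by
      intro i hi
      rw [Finset.mem_Icc] at hi
      refine Integrable.mul_const ?_ _
      exact H.integrable_mul (H.aestronglyMeasurable_comp
        (g := fun x => x ^ (i - (k + 1)) / B.charpoly.eval x)
        ((by fun_prop : Measurable fun x : ℂ => x ^ (i - (k + 1))).div
          B.charpoly.continuous.measurable)) D fun a ha => hb _ ha _ (by omega)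
    refine (integrable_finsetSum _ h1).congr (Eventually.of_forall fun a => ?_)
    simp only [Finset.mul_sum]
    refine Finset.sum_congr rfl fun i _ => ?_
    ring
  have hL : ∀ (L : ℂ[X] →ₗ[ℂ] ℂ) (x : ℂ), L (B.charpoly /ₘ (X - C x)) =
      ∑ k ∈ Finset.range (m + 1), (B.charpoly /ₘ (X - C x)).coeff k * L (X ^ k) := by
    intro L x
    conv_lhs => rw [as_sum_range' _ _ (natDegree_charpoly_divByMonic_lt (B := B) x)]
    rw [map_sum]
    refine Finset.sum_congr rfl fun k _ => ?_
    rw [← C_mul_X_pow_eq_monomial, C_mul', map_smul, smul_eq_mul]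
  have hsum : ∀ (L : ℂ[X] →ₗ[ℂ] ℂ) (a : α),
      φ a * ((B.charpoly.eval (w a))⁻¹ * L (B.charpoly /ₘ (X - C (w a)))) =
      ∑ k ∈ Finset.range (m + 1), φ a * ((B.charpoly.eval (w a))⁻¹ *
        (B.charpoly /ₘ (X - C (w a))).coeff k) * L (X ^ k) := by
    intro L a
    rw [hL, Finset.mul_sum, Finset.mul_sum]
    exact Finset.sum_congr rfl fun k _ => by ring
  refine ⟨∑ k ∈ Finset.range (m + 1), (∫ a, φ a * ((B.charpoly.eval (w a))⁻¹ *
      (B.charpoly /ₘ (X - C (w a))).coeff k) ∂μ) • X ^ k, fun L => ⟨?_, ?_⟩⟩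
  · simp_rw [hsum]
    exact integrable_finsetSum _ fun k _ => (hint k).mul_const _
  · simp_rw [hsum]
    rw [integral_finsetSum _ fun k _ => (hint k).mul_const _, map_sum]
    refine Finset.sum_congr rfl fun k _ => ?_
    rw [map_smul, smul_eq_mul, integral_mul_const]

end CauchyDatum

theorem iteratedDeriv_polynomial_eval (P : ℂ[X]) (j : ℕ) :
    iteratedDeriv j (fun z => P.eval z) = fun z => (derivative^[j] P).eval z := by
  induction j with
  | zero => simp
  | succ j ih =>
    rw [iteratedDeriv_succ, ih]
    ext z
    rw [Polynomial.deriv, Function.iterate_succ_apply']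

/-- A multiple of the characteristic polynomial by an analytic function vanishes at each eigenvalue
to at least its multiplicity, so it does not affect the interpolated derivatives. -/
theorem interpolatesOnSpectrum_of_eventuallyEq {f g : ℂ → ℂ} {P : ℂ[X]}
    (h : ∀ μ, B.charpoly.IsRoot μ → AnalyticAt ℂ g μ ∧
      ∀ᶠ z in 𝓝 μ, f z = P.eval z + B.charpoly.eval z * g z) :
    InterpolatesOnSpectrum f B P := by
  intro μ hμ
  obtain ⟨hg, hf⟩ := h μ hμ
  have hP : ∀ Q : ℂ[X], AnalyticAt ℂ (fun z => Q.eval z) μ := fun Q =>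
    (Q.differentiable.differentiableOn (s := univ)).analyticAt univ_mem
  have hr : AnalyticAt ℂ (fun z => B.charpoly.eval z * g z) μ := (hP _).mul hg
  refine ⟨((hP P).add hr).congr (hf.mono fun z hz => hz.symm), fun j hj => ?_⟩
  rw [Filter.EventuallyEq.iteratedDeriv_eq j hf, iteratedDeriv_fun_add (hP P).contDiffAt
    hr.contDiffAt, iteratedDeriv_polynomial_eval]
  have h0 : ∀ i < B.charpoly.rootMultiplicity μ,
      iteratedDeriv i (fun z => B.charpoly.eval z * g z) μ = 0 := by
    rw [← natCast_le_analyticOrderAt_iff_iteratedDeriv_eq_zero hr, natCast_le_analyticOrderAt hr]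
    obtain ⟨Q, hQ⟩ := pow_rootMultiplicity_dvd B.charpoly μ
    refine ⟨fun z => Q.eval z * g z, (hP Q).mul hg, Eventually.of_forall fun z => ?_⟩
    conv_lhs => rw [hQ]
    simp [mul_assoc]
  rw [h0 j hj, add_zero]

theorem InterpolatesOnSpectrum.add {f g : ℂ → ℂ} {P Q : ℂ[X]} (hf : InterpolatesOnSpectrum f B P)
    (hg : InterpolatesOnSpectrum g B Q) :
    InterpolatesOnSpectrum (fun z => f z + g z) B (P + Q) := by
  intro μ hμ
  obtain ⟨hf1, hf2⟩ := hf μ hμ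
  obtain ⟨hg1, hg2⟩ := hg μ hμ
  refine ⟨hf1.add hg1, fun j hj => ?_⟩
  rw [iterate_map_add, eval_add, hf2 j hj, hg2 j hj,
    iteratedDeriv_fun_add hf1.contDiffAt hg1.contDiffAt]

theorem InterpolatesOnSpectrum.congr {f g : ℂ → ℂ} {P : ℂ[X]} (hf : InterpolatesOnSpectrum f B P)
    (h : ∀ μ, B.charpoly.IsRoot μ → f =ᶠ[𝓝 μ] g) : InterpolatesOnSpectrum g B P := by
  intro μ hμ
  obtain ⟨hf1, hf2⟩ := hf μ hμ
  refine ⟨hf1.congr (h μ hμ), fun j hj => ?_⟩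
  rw [hf2 j hj, (h μ hμ).iteratedDeriv_eq]

/-- Two interpolants differ by a polynomial vanishing at every eigenvalue to its algebraic
multiplicity. Such a polynomial is divisible by the characteristic polynomial, hence annihilates
`B`. -/
theorem InterpolatesOnSpectrum.aeval_eq {f : ℂ → ℂ} {P Q : ℂ[X]} (hP : InterpolatesOnSpectrum f B P)
    (hQ : InterpolatesOnSpectrum f B Q) : aeval B P = aeval B Q := by
  rcases eq_or_ne (P - Q) 0 with h0 | h0
  · rw [sub_eq_zero.1 h0]
  have hdvd : B.charpoly ∣ P - Q := by
    rw [(IsAlgClosed.splits B.charpoly).eq_prod_roots_of_monic (Matrix.charpoly_monic B),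
      Multiset.prod_X_sub_C_dvd_iff_le_roots h0, Multiset.le_iff_count]
    intro μ
    rw [count_roots, count_roots]
    rcases Nat.eq_zero_or_pos (B.charpoly.rootMultiplicity μ) with h1 | h1
    · rw [h1]; exact Nat.zero_le _
    have hμ : B.charpoly.IsRoot μ :=
      (rootMultiplicity_pos (Matrix.charpoly_monic B).ne_zero).1 h1
    obtain ⟨k, hk⟩ := Nat.exists_eq_add_of_lt h1
    rw [zero_add] at hk
    rw [hk, Nat.succ_le_iff, lt_rootMultiplicity_iff_isRoot_iterate_derivative h0]
    intro j hj
    rw [IsRoot.def, iterate_derivative_sub, eval_sub, (hP μ hμ).2 j (by omega),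
      (hQ μ hμ).2 j (by omega), sub_self]
  obtain ⟨R, hR⟩ := hdvd
  rw [← sub_eq_zero, ← map_sub, hR, map_mul, Matrix.aeval_self_charpoly, zero_mul]

theorem InterpolatesOnSpectrum.matrixFunction_eq {f : ℂ → ℂ} {P : ℂ[X]}
    (hP : InterpolatesOnSpectrum f B P) : matrixFunction f B = aeval B P := by
  have H : ∃ p : ℂ[X], InterpolatesOnSpectrum f B p := ⟨P, hP⟩
  rw [matrixFunction, dif_pos H]
  exact H.choose_spec.aeval_eq hP

/-- Integrate `1 / (w - z) = Q_w(z) / χ(w) + χ(z) / (χ(w) (w - z))` against `φ`: the first term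
gives a polynomial `P`, the second `χ` times another Cauchy transform, analytic near the spectrum.
So `P` interpolates, and `Q_w(B) / χ(w) = (w - B)⁻¹`. -/
theorem CauchyDatum.exists_interpolant {α : Type*} [MeasurableSpace α] {μ : Measure α}
    {w φ : α → ℂ} (H : CauchyDatum μ w φ) (hB : ∀ μ, B.charpoly.IsRoot μ → 0 < μ.re) :
    ∃ P : ℂ[X], InterpolatesOnSpectrum (fun z => ∫ a, φ a / (w a - z) ∂μ) B P ∧ ∀ i j,
      aeval B P i j =
        ∫ a, φ a * (w a • (1 : Matrix (Fin (m + 1)) (Fin (m + 1)) ℂ) - B)⁻¹ i j ∂μ := by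
  obtain ⟨P, hP⟩ := H.exists_polynomial hB
  obtain ⟨D, hD, hb⟩ := exists_norm_pow_div_charpoly_le hB
  have hb0 : ∀ z : ℂ, z.re ≤ 0 → ‖(B.charpoly.eval z)⁻¹‖ ≤ D := by
    intro z hz
    have h1 := hb z hz 0 (Nat.zero_le _)
    rw [pow_zero, one_div] at h1
    refine h1.trans (div_le_self hD.le ?_)
    linarith [norm_nonneg z]
  have H' : CauchyDatum μ w (fun a => φ a * (B.charpoly.eval (w a))⁻¹) :=
    H.mul_comp (g := fun z => (B.charpoly.eval z)⁻¹) B.charpoly.continuous.measurable.inv D hb0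
  refine ⟨P, interpolatesOnSpectrum_of_eventuallyEq
    (g := fun z => ∫ a, φ a * (B.charpoly.eval (w a))⁻¹ / (w a - z) ∂μ) fun ν hν =>
      ⟨H'.analyticAt (hB ν hν), ?_⟩, fun i j => ?_⟩
  · filter_upwards [(isOpen_lt continuous_const continuous_re).mem_nhds (hB ν hν)] with z hz
    obtain ⟨h1, h2⟩ := hP (leval z)
    simp only [leval_apply] at h1 h2
    rw [h2, ← integral_const_mul, ← integral_add h1 ((H'.integrable_div hz).const_mul _)]
    refine integral_congr_ae ?_
    filter_upwards [H.re_nonpos] with a ha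
    have h3 : w a - z ≠ 0 := fun h => absurd (sub_eq_zero.1 h ▸ ha) (not_le.2 hz)
    have h4 := eval_charpoly_ne_zero hB ha
    have h5 := congrArg (eval z) (X_sub_C_mul_divByMonic B.charpoly (w a))
    simp only [eval_mul, eval_sub, eval_X, eval_C] at h5
    field_simp
    linear_combination φ a * h5
  · let L : ℂ[X] →ₗ[ℂ] ℂ := (Matrix.entryLinearMap ℂ ℂ i j).comp (aeval B).toLinearMap
    obtain ⟨h1, h2⟩ := hP L
    change L P = _
    rw [h2]
    refine integral_congr_ae ?_
    filter_upwards [H.re_nonpos] with a ha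
    rw [resolvent_eq_aeval (eval_charpoly_ne_zero hB ha)]
    rfl

end Interpolation

/-! ### Cauchy's theorem on unbounded quadrants. -/

section Quadrant

/-- An even integrable majorant on the real line, singular like `|t|^{-1/2}` at the origin and
decaying like `|t|^{-3/2}`. -/
noncomputable def decayBound (t : ℝ) : ℝ := (√|t| * (1 + |t|))⁻¹

theorem decayBound_nonneg (t : ℝ) : 0 ≤ decayBound t := by unfold decayBound; positivity

/-- The point `s = 0` is excluded because the formula takes the default value `0` there. -/
theorem decayBound_anti {s t : ℝ} (hs : s ≠ 0) (h : |s| ≤ |t|) : decayBound t ≤ decayBound s := by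
  unfold decayBound
  have : 0 < |s| := abs_pos.2 hs
  gcongr

theorem measurable_decayBound : Measurable decayBound := by unfold decayBound; fun_prop

theorem integrableOn_decayBound_Ioi : IntegrableOn decayBound (Ioi 0) := by
  rw [← Ioc_union_Ioi_eq_Ioi zero_le_one]
  refine IntegrableOn.union ?_ ?_
  · have h : IntegrableOn (fun t : ℝ => t ^ (-(1 / 2) : ℝ)) (Ioc 0 1) :=
      (intervalIntegrable_iff_integrableOn_Ioc_of_le zero_le_one).1
        (intervalIntegral.intervalIntegrable_rpow' (by norm_num))
    refine h.mono' measurable_decayBound.aestronglyMeasurable ?_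
    refine (ae_restrict_iff' measurableSet_Ioc).2 (Eventually.of_forall fun t ht => ?_)
    have ht0 : 0 < t := ht.1
    rw [Real.norm_of_nonneg (decayBound_nonneg t), decayBound, abs_of_pos ht0,
      Real.rpow_neg ht0.le, ← Real.sqrt_eq_rpow]
    have := Real.sqrt_pos.2 ht0
    gcongr
    nlinarith
  · refine (integrableOn_Ioi_rpow_of_lt (a := (-(3 / 2) : ℝ)) (by norm_num) zero_lt_one).mono'
      measurable_decayBound.aestronglyMeasurable ?_
    refine (ae_restrict_iff' measurableSet_Ioi).2 (Eventually.of_forall fun t ht => ?_)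
    have ht0 : 0 < t := zero_lt_one.trans ht
    rw [Real.norm_of_nonneg (decayBound_nonneg t), decayBound, abs_of_pos ht0,
      Real.rpow_neg ht0.le, show (3 / 2 : ℝ) = 1 / 2 + 1 by norm_num, Real.rpow_add ht0,
      ← Real.sqrt_eq_rpow, Real.rpow_one]
    have := Real.sqrt_pos.2 ht0
    gcongr
    linarith

theorem integrable_decayBound : Integrable decayBound := by
  have h1 := integrableOn_decayBound_Ioi
  have h2 : IntegrableOn decayBound (Iic 0) := by
    rw [integrableOn_Iic_iff_integrableOn_Iio]
    have h3 := (integrable_indicator_iff measurableSet_Ioi).2 h1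
    refine (integrable_indicator_iff measurableSet_Iio).1 (h3.comp_neg.congr ?_)
    exact Eventually.of_forall fun t => by simp [indicator, decayBound]
  rw [← integrableOn_univ, ← Iic_union_Ioi (a := (0 : ℝ))]
  exact h2.union h1

/-- Dominated convergence in which integrand and endpoints move together. The majorant may be
singular at `0`, and integrability of the limit is part of the conclusion. -/
theorem tendsto_intervalIntegral_of_le {F : ℕ → ℝ → ℂ} {f : ℝ → ℂ} {b : ℝ → ℝ} {a r : ℕ → ℝ}
    {a₀ : ℝ} (ha : ∀ n, a₀ ≤ a n) (har : ∀ n, a n ≤ r n) (ha' : Tendsto a atTop (𝓝 a₀))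
    (hr : Tendsto r atTop atTop)
    (hF : ∀ n, AEStronglyMeasurable (F n) (volume.restrict (Ioc (a n) (r n))))
    (hb : ∀ n, ∀ x ∈ Ioc (a n) (r n), x ≠ 0 → ‖F n x‖ ≤ b x)
    (hb0 : ∀ x, 0 ≤ b x) (hbi : Integrable b)
    (hlim : ∀ x, a₀ < x → x ≠ 0 → Tendsto (fun n => F n x) atTop (𝓝 (f x))) :
    IntegrableOn f (Ioi a₀) ∧
      Tendsto (fun n => ∫ x in a n..r n, F n x) atTop (𝓝 (∫ x in Ioi a₀, f x)) := by
  have h0 : ∀ᵐ x : ℝ, x ≠ 0 := Measure.ae_ne volume 0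
  have hm : ∀ n, AEStronglyMeasurable ((Ioc (a n) (r n)).indicator (F n))
      (volume.restrict (Ioi a₀)) := fun n =>
    AEStronglyMeasurable.restrict ((aestronglyMeasurable_indicator_iff measurableSet_Ioc).2 (hF n))
  have hbd : ∀ n, ∀ᵐ x ∂volume.restrict (Ioi a₀), ‖(Ioc (a n) (r n)).indicator (F n) x‖ ≤ b x := by
    intro n
    filter_upwards [ae_restrict_of_ae h0] with x hx
    by_cases h : x ∈ Ioc (a n) (r n)
    · rw [indicator_of_mem h]; exact hb n x h hx
    · rw [indicator_of_notMem h, norm_zero]; exact hb0 x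
  have hl : ∀ᵐ x ∂volume.restrict (Ioi a₀),
      Tendsto (fun n => (Ioc (a n) (r n)).indicator (F n) x) atTop (𝓝 (f x)) := by
    filter_upwards [ae_restrict_of_ae h0, ae_restrict_mem measurableSet_Ioi] with x hx hxa
    refine (hlim x hxa hx).congr' ?_
    filter_upwards [ha'.eventually (gt_mem_nhds hxa), hr.eventually_ge_atTop x] with n h1 h2
    rw [indicator_of_mem (show x ∈ Ioc (a n) (r n) from ⟨h1, h2⟩)]
  constructor
  · refine hbi.integrableOn.mono' (aestronglyMeasurable_of_tendsto_ae atTop hm hl) ?_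
    filter_upwards [hl, ae_all_iff.2 hbd] with x h1 h2
    exact le_of_tendsto h1.norm (Eventually.of_forall h2)
  · have := tendsto_integral_filter_of_dominated_convergence b (Eventually.of_forall hm)
      (Eventually.of_forall hbd) hbi.integrableOn hl
    refine this.congr fun n => ?_
    rw [intervalIntegral.integral_of_le (har n), setIntegral_indicator measurableSet_Ioc,
      inter_eq_self_of_subset_right]
    exact fun x hx => (ha n).trans_lt hx.1

theorem integral_rect_eq_zero {G : ℂ → ℂ} {s a R ε : ℝ} (hs : s = 1 ∨ s = -1) (ha : a ≤ R)
    (hε : ε ≤ R) (hd : DifferentiableOn ℂ G {w | a ≤ w.re ∧ ε ≤ s * w.im}) :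
    (∫ x in a..R, G (x + s * ε * I)) - (∫ x in a..R, G (x + s * R * I)) +
      s * I * (∫ y in ε..R, G (R + s * y * I)) - s * I * (∫ y in ε..R, G (a + s * y * I)) = 0 := by
  have hs0 : s ≠ 0 := by rcases hs with h | h <;> simp [h]
  have hss : s⁻¹ = s := by rcases hs with h | h <;> norm_num [h]
  have key := integral_boundary_rect_eq_zero_of_differentiableOn G ⟨a, s * ε⟩ ⟨R, s * R⟩
    (hd.mono ?_)
  · simp only [smul_eq_mul] at key
    have h1 : ∀ c : ℝ, ∫ y in ε..R, G (c + s * y * I) =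
        s * ∫ y in s * ε..s * R, G (c + y * I) := by
      intro c
      have := intervalIntegral.integral_comp_mul_left (a := ε) (b := R)
        (fun y : ℝ => G (c + y * I)) hs0
      simp only [ofReal_mul] at this
      rw [this, hss, real_smul]
    have h2 : (s : ℂ) * s = 1 := by rcases hs with h | h <;> simp [h]
    rw [h1, h1]
    push_cast at key
    linear_combination key + (I * (∫ y in s * ε..s * R, G (R + y * I)) -
      I * (∫ y in s * ε..s * R, G (a + y * I))) * h2
  · intro w hw
    obtain ⟨hw1, hw2⟩ := mem_reProdIm.1 hw
    simp only [uIcc_of_le ha] at hw1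
    refine ⟨hw1.1, ?_⟩
    rcases hs with h | h
    · subst h
      simp only [one_mul, uIcc_of_le hε] at hw2 ⊢
      exact hw2.1
    · subst h
      rw [uIcc_of_ge (by linarith)] at hw2
      have := hw2.2
      simp only at this
      linarith

/-- Cauchy's theorem on the quadrants `{Re w > -ξ, ± Im w > 0}`. -/
theorem integral_quadrant {G : ℂ → ℂ} {g : ℝ → ℂ} {s ξ K : ℝ} (hs : s = 1 ∨ s = -1) (hξ : 0 < ξ)
    (hK : 0 ≤ K)
    (hd : DifferentiableOn ℂ G {w | -ξ ≤ w.re ∧ 0 < s * w.im})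
    (hb : ∀ w : ℂ, -ξ ≤ w.re → 0 < s * w.im → ‖G w‖ ≤ K * decayBound ‖w‖)
    (hg : ∀ x : ℝ, -ξ < x → x ≠ 0 →
      Tendsto (fun ε : ℝ => G (x + s * ε * I)) (𝓝[>] 0) (𝓝 (g x))) :
    IntegrableOn g (Ioi (-ξ)) ∧ IntegrableOn (fun y : ℝ => G (-ξ + s * y * I)) (Ioi 0) ∧
      ∫ x in Ioi (-ξ), g x = s * I * ∫ y in Ioi (0 : ℝ), G (-ξ + s * y * I) := by
  have hss : s * s = 1 := by rcases hs with h | h <;> norm_num [h]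
  have hs1 : |s| = 1 := by rcases hs with h | h <;> simp [h]
  have hre : ∀ x y : ℝ, ((x : ℂ) + s * y * I).re = x := by intro x y; simp
  have him : ∀ x y : ℝ, ((x : ℂ) + s * y * I).im = s * y := by intro x y; simp
  have him' : ∀ x y : ℝ, s * ((x : ℂ) + s * y * I).im = y := by
    intro x y; rw [him, ← mul_assoc, hss, one_mul]
  have hnx : ∀ x y : ℝ, |x| ≤ |‖(x : ℂ) + s * y * I‖| := by
    intro x y
    rw [abs_norm]
    simpa [hre] using abs_re_le_norm ((x : ℂ) + s * y * I)
  have hny : ∀ x y : ℝ, |y| ≤ |‖(x : ℂ) + s * y * I‖| := by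
    intro x y
    have := abs_im_le_norm ((x : ℂ) + s * y * I)
    rwa [him, abs_mul, hs1, one_mul, ← abs_norm] at this
  have hcont : ∀ f : ℝ → ℂ, Continuous f → ∀ S : Set ℝ,
      (∀ t ∈ S, -ξ ≤ (f t).re ∧ 0 < s * (f t).im) → ContinuousOn (fun t => G (f t)) S :=
    fun f hf S h => hd.continuousOn.comp hf.continuousOn h
  -- The quadrant is exhausted by rectangles with far sides at distance `r n` and near horizontal
  -- side at height `(r n)⁻¹`. The two far sides contribute length times `O((r n)^(-3/2))`, which
  -- tends to zero.
  set r : ℕ → ℝ := fun n => n + 1 with hr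
  have hr1 : ∀ n, 1 ≤ r n := fun n => by simp [hr]
  have hr0 : ∀ n, 0 < r n := fun n => zero_lt_one.trans_le (hr1 n)
  have hrt : Tendsto r atTop atTop := tendsto_atTop_add_const_right _ _ tendsto_natCast_atTop_atTop
  have hri : Tendsto (fun n => (r n)⁻¹) atTop (𝓝 0) := hrt.inv_tendsto_atTop
  have hri' : Tendsto (fun n => (r n)⁻¹) atTop (𝓝[>] 0) :=
    tendsto_nhdsWithin_iff.2 ⟨hri, Eventually.of_forall fun n => inv_pos.2 (hr0 n)⟩
  have hrl : ∀ n, (r n)⁻¹ ≤ r n := fun n => (inv_le_one_of_one_le₀ (hr1 n)).trans (hr1 n)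
  have hKb : Integrable fun x => K * decayBound x := integrable_decayBound.const_mul K
  have hKb0 : ∀ x, 0 ≤ K * decayBound x := fun x => mul_nonneg hK (decayBound_nonneg x)
  obtain ⟨i1, t1⟩ := tendsto_intervalIntegral_of_le (F := fun n x => G (x + s * (r n)⁻¹ * I))
    (f := g) (b := fun x => K * decayBound x) (a := fun _ => -ξ) (r := r) (a₀ := -ξ)
    (fun _ => le_rfl) (fun n => by linarith [hr0 n]) tendsto_const_nhds hrt
    (fun n => (hcont _ (by fun_prop) _ fun t ht => by
      have h := ht.1.le
      have h1 := him' t (r n)⁻¹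
      have h2 := hre t (r n)⁻¹
      rw [h1, h2]
      exact ⟨h, inv_pos.2 (hr0 n)⟩).aestronglyMeasurable measurableSet_Ioc)
    (fun n x hx hx0 => by
      have h1 := him' x (r n)⁻¹
      have h2 := hre x (r n)⁻¹
      have h3 := hnx x (r n)⁻¹
      refine (hb _ ?_ ?_).trans (mul_le_mul_of_nonneg_left (decayBound_anti hx0 h3) hK)
      · rw [h2]; exact hx.1.le
      · rw [h1]; exact inv_pos.2 (hr0 n))
    hKb0 hKb
    (fun x hx hx0 => by
      have := (hg x hx hx0).comp hri'
      simpa [Function.comp_def] using this)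
  obtain ⟨i4, t4⟩ := tendsto_intervalIntegral_of_le (F := fun _ y => G (-ξ + s * y * I))
    (f := fun y => G (-ξ + s * y * I)) (b := fun x => K * decayBound x)
    (a := fun n => (r n)⁻¹) (r := r) (a₀ := 0)
    (fun n => (inv_pos.2 (hr0 n)).le) hrl hri hrt
    (fun n => (hcont _ (by fun_prop) _ fun t ht => by
      have h1 := him' (-ξ) t
      have h2 := hre (-ξ) t
      simp only [ofReal_neg] at h1 h2
      rw [h1, h2]
      exact ⟨le_rfl, (inv_pos.2 (hr0 n)).trans ht.1⟩).aestronglyMeasurable measurableSet_Ioc)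
    (fun n y hy hy0 => by
      have h1 := him' (-ξ) y
      have h2 := hre (-ξ) y
      have h3 := hny (-ξ) y
      simp only [ofReal_neg] at h1 h2 h3
      refine (hb _ ?_ ?_).trans (mul_le_mul_of_nonneg_left (decayBound_anti hy0 h3) hK)
      · rw [h2]
      · rw [h1]; exact (inv_pos.2 (hr0 n)).trans hy.1)
    hKb0 hKb (fun y _ _ => tendsto_const_nhds)
  refine ⟨i1, i4, ?_⟩
  have hsq : Tendsto (fun n => K * (1 + ξ) * (√(r n))⁻¹) atTop (𝓝 0) := by
    have := (Real.tendsto_sqrt_atTop.comp hrt).inv_tendsto_atTop.const_mul (K * (1 + ξ))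
    rw [mul_zero] at this
    exact this
  have hdr : ∀ n, K * decayBound (r n) * (r n + ξ) ≤ K * (1 + ξ) * (√(r n))⁻¹ := by
    intro n
    have h1 := hr0 n
    have h2 : 0 < √(r n) := Real.sqrt_pos.2 h1
    rw [decayBound, abs_of_pos h1, mul_inv, mul_assoc, mul_assoc K (1 + ξ)]
    refine mul_le_mul_of_nonneg_left ?_ hK
    rw [mul_assoc, mul_comm]
    refine mul_le_mul_of_nonneg_right ?_ (inv_pos.2 h2).le
    rw [inv_mul_le_iff₀ (by linarith)]
    nlinarith
  have t2 : Tendsto (fun n => ∫ x in (-ξ)..r n, G (x + s * r n * I)) atTop (𝓝 0) := by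
    refine squeeze_zero_norm (fun n => ?_) hsq
    refine le_trans (intervalIntegral.norm_integral_le_of_norm_le_const
      (C := K * decayBound (r n)) fun x hx => ?_) (le_trans (le_of_eq ?_) (hdr n))
    · rw [uIoc_of_le (by linarith [hr0 n])] at hx
      refine (hb _ ?_ ?_).trans (mul_le_mul_of_nonneg_left
        (decayBound_anti (hr0 n).ne' (hny _ _)) hK)
      · rw [hre]; exact hx.1.le
      · rw [him']; exact hr0 n
    · rw [abs_of_nonneg (by linarith [hr0 n])]; ring
  have t3 : Tendsto (fun n => ∫ y in (r n)⁻¹..r n, G (r n + s * y * I)) atTop (𝓝 0) := by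
    refine squeeze_zero_norm (fun n => ?_) hsq
    refine le_trans (intervalIntegral.norm_integral_le_of_norm_le_const
      (C := K * decayBound (r n)) fun y hy => ?_) (le_trans ?_ (hdr n))
    · rw [uIoc_of_le (hrl n)] at hy
      refine (hb _ ?_ ?_).trans (mul_le_mul_of_nonneg_left
        (decayBound_anti (hr0 n).ne' (hnx _ _)) hK)
      · rw [hre]; linarith [hr0 n]
      · rw [him']; exact (inv_pos.2 (hr0 n)).trans hy.1
    · refine mul_le_mul_of_nonneg_left ?_ (hKb0 _)
      rw [abs_of_nonneg (by linarith [hrl n])]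
      linarith [inv_pos.2 (hr0 n)]
  have hid : ∀ n, _ := fun n => integral_rect_eq_zero (G := G) (a := -ξ) (R := r n)
    (ε := (r n)⁻¹) hs (by linarith [hr0 n]) (hrl n)
    (hd.mono fun w hw => ⟨hw.1, (inv_pos.2 (hr0 n)).trans_le hw.2⟩)
  have hlim := ((t1.sub t2).add (t3.const_mul (s * I))).sub (t4.const_mul (s * I))
  have h0 := tendsto_nhds_unique (hlim.congr' (Eventually.of_forall fun n => by
    have := hid n
    simp only [ofReal_neg] at this
    exact this)) tendsto_const_nhds
  linear_combination h0

end Quadrant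

/-! ### The square root and the size of the transfer function. -/

section TransferFunction

theorem exp_neg_pi_mul_I_div_four :
    Complex.exp (-(Real.pi * I) / 4) = ((√2 / 2 : ℝ) : ℂ) * (1 - I) := by
  have h : -(Real.pi * I) / 4 = ((-(Real.pi / 4) : ℝ) : ℂ) * I := by push_cast; ring
  rw [h, exp_mul_I, ← ofReal_cos, ← ofReal_sin, Real.cos_neg, Real.sin_neg, Real.cos_pi_div_four,
    Real.sin_pi_div_four]
  push_cast
  ring

theorem re_exp_neg_pi_mul_I_div_four_mul (s : ℂ) :
    (Complex.exp (-(Real.pi * I) / 4) * s).re = √2 / 2 * (s.re + s.im) := by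
  rw [exp_neg_pi_mul_I_div_four, mul_assoc, re_ofReal_mul]
  simp

theorem norm_exp_neg_pi_mul_I_div_four : ‖Complex.exp (-(Real.pi * I) / 4)‖ = 1 := by
  rw [show -(Real.pi * I) / 4 = ((-(Real.pi / 4) : ℝ) : ℂ) * I by push_cast; ring]
  exact norm_exp_ofReal_mul_I _

theorem norm_transferOfSqrt (d : ℝ) (s : ℂ) :
    ‖transferOfSqrt d s‖ =
      Real.exp (-d * (Complex.exp (-(Real.pi * I) / 4) * s).re) / (2 * ‖s‖) := by
  rw [transferOfSqrt, norm_div, norm_mul, norm_mul, norm_exp_neg_pi_mul_I_div_four, Complex.norm_exp,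
    neg_re, re_ofReal_mul, RCLike.norm_ofNat, one_mul, neg_mul]

theorem cpow_half_sq (w : ℂ) : (w ^ (1 / 2 : ℂ)) ^ 2 = w := by
  rw [one_div]
  exact cpow_nat_inv_pow w two_ne_zero

theorem norm_cpow_half (w : ℂ) : ‖w ^ (1 / 2 : ℂ)‖ = √‖w‖ := by
  rw [eq_comm, Real.sqrt_eq_iff_mul_self_eq (norm_nonneg _) (norm_nonneg _), ← norm_mul, ← sq,
    cpow_half_sq]

theorem cpow_half_eq {w : ℂ} (hw : w ≠ 0) :
    w ^ (1 / 2 : ℂ) = (√‖w‖ : ℂ) * (Real.cos (w.arg / 2) + Real.sin (w.arg / 2) * I) := by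
  rw [cpow_def_of_ne_zero hw, Complex.log, show ((Real.log ‖w‖ : ℂ) + w.arg * I) * (1 / 2) =
    ((Real.log ‖w‖ * (1 / 2) : ℝ) : ℂ) + ((w.arg / 2 : ℝ) : ℂ) * I by push_cast; ring,
    Complex.exp_add, ← ofReal_exp, ← Real.rpow_def_of_pos (norm_pos_iff.2 hw), ← Real.sqrt_eq_rpow,
    exp_mul_I, ofReal_cos, ofReal_sin]

theorem cpow_half_re_nonneg (w : ℂ) : 0 ≤ (w ^ (1 / 2 : ℂ)).re := by
  rcases eq_or_ne w 0 with rfl | hw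
  · simp
  rw [cpow_half_eq hw, re_ofReal_mul]
  refine mul_nonneg (Real.sqrt_nonneg _) ?_
  simp only [add_re, ofReal_re, mul_re, I_re, mul_zero, ofReal_im, I_im, mul_one, sub_self,
    add_zero]
  exact Real.cos_nonneg_of_mem_Icc
    ⟨by linarith [neg_pi_lt_arg w], by linarith [arg_le_pi w]⟩

theorem cpow_half_im_nonneg {w : ℂ} (h : 0 ≤ w.im) : 0 ≤ (w ^ (1 / 2 : ℂ)).im := by
  rcases eq_or_ne w 0 with rfl | hw
  · simp
  rw [cpow_half_eq hw, im_ofReal_mul]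
  refine mul_nonneg (Real.sqrt_nonneg _) ?_
  simp only [add_im, ofReal_im, mul_im, I_re, mul_zero, ofReal_re, I_im, mul_one, zero_add,
    add_zero]
  exact Real.sin_nonneg_of_nonneg_of_le_pi (by linarith [arg_nonneg_iff.2 h])
    (by linarith [arg_le_pi w, Real.pi_pos])

theorem re_sq_eq (s : ℂ) : (s ^ 2).re = s.re ^ 2 - s.im ^ 2 := by
  rw [sq, mul_re]; ring

theorem sqrt_two_div_two_mul_sqrt (ξ : ℝ) : √2 / 2 * √ξ = √(ξ / 2) := by
  rw [Real.sqrt_div' _ zero_le_two]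
  have h : √2 * √2 = 2 := Real.mul_self_sqrt zero_le_two
  rw [div_mul_eq_mul_div, div_eq_div_iff two_ne_zero (by positivity)]
  linear_combination √ξ * h

/-- The real part of `√(w/i)` is at least `-√(ξ/2)` to the right of the line `Re w = -ξ`. -/
theorem neg_sqrt_le_re_sqrt {ξ : ℝ} {w : ℂ} (hξ : 0 ≤ ξ) (hw : -ξ ≤ w.re) :
    -√(ξ / 2) ≤ (Complex.exp (-(Real.pi * I) / 4) * w ^ (1 / 2 : ℂ)).re := by
  rw [re_exp_neg_pi_mul_I_div_four_mul, ← sqrt_two_div_two_mul_sqrt, ← mul_neg]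
  refine mul_le_mul_of_nonneg_left ?_ (by positivity)
  have h1 := cpow_half_re_nonneg w
  have h2 := re_sq_eq (w ^ (1 / 2 : ℂ))
  rw [cpow_half_sq] at h2
  set c := (w ^ (1 / 2 : ℂ)).re
  set a := (w ^ (1 / 2 : ℂ)).im
  -- If `c + a < -√ξ` with `c ≥ 0`, then `a² > (√ξ + c)² ≥ ξ + c²`, against `c² - a² = Re w ≥ -ξ`.
  by_contra! h
  have h3 : √ξ ^ 2 = ξ := Real.sq_sqrt hξ
  have h4 := Real.sqrt_nonneg ξ
  nlinarith

/-- On the upper half of the line `Re w = -ξ` the real part of `√(w/i)` is at least `√(ξ/2)`. -/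
theorem sqrt_le_re_sqrt {ξ : ℝ} {w : ℂ} (hw : w.re = -ξ) (him : 0 ≤ w.im) :
    √(ξ / 2) ≤ (Complex.exp (-(Real.pi * I) / 4) * w ^ (1 / 2 : ℂ)).re := by
  rw [re_exp_neg_pi_mul_I_div_four_mul, ← sqrt_two_div_two_mul_sqrt]
  refine mul_le_mul_of_nonneg_left ?_ (by positivity)
  have h1 := cpow_half_re_nonneg w
  have h2 := re_sq_eq (w ^ (1 / 2 : ℂ))
  have h5 := cpow_half_im_nonneg him
  rw [cpow_half_sq] at h2
  set c := (w ^ (1 / 2 : ℂ)).re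
  set a := (w ^ (1 / 2 : ℂ)).im
  refine Real.sqrt_le_iff.2 ⟨by positivity, ?_⟩
  -- For `a, c ≥ 0`, `(c + a)² ≥ a² - c² = ξ`.
  nlinarith

theorem norm_transferFn (x : ℝ) (w : ℂ) : ‖transferFn x w‖ =
    Real.exp (-|x| * (Complex.exp (-(Real.pi * I) / 4) * w ^ (1 / 2 : ℂ)).re) / (2 * √‖w‖) := by
  rw [transferFn, norm_transferOfSqrt, norm_cpow_half]

theorem norm_transferFn_le (x : ℝ) {ξ : ℝ} {w : ℂ} (hξ : 0 ≤ ξ) (hw : -ξ ≤ w.re) :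
    ‖transferFn x w‖ ≤ Real.exp (|x| * √(ξ / 2)) / √‖w‖ := by
  rw [norm_transferFn, ← div_div]
  refine div_le_div_of_nonneg_right ((div_le_self (Real.exp_pos _).le one_le_two).trans ?_)
    (Real.sqrt_nonneg _)
  refine Real.exp_le_exp.2 ?_
  have := mul_le_mul_of_nonneg_left (neg_sqrt_le_re_sqrt hξ hw) (abs_nonneg x)
  linarith

theorem transferOfSqrt_differentiableAt (d : ℝ) {s : ℂ} (hs : s ≠ 0) :
    DifferentiableAt ℂ (transferOfSqrt d) s := by
  unfold transferOfSqrt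
  refine DifferentiableAt.div (by fun_prop) (by fun_prop) ?_
  simp [hs]

theorem transferFn_differentiableAt (x : ℝ) {w : ℂ} (hw : w ∈ slitPlane) :
    DifferentiableAt ℂ (transferFn x) w := by
  have hs : w ^ (1 / 2 : ℂ) ≠ 0 := by
    rw [cpow_def_of_ne_zero (slitPlane_ne_zero hw)]
    exact Complex.exp_ne_zero _
  exact (transferOfSqrt_differentiableAt |x| hs).comp w
    (differentiableAt_id.cpow (differentiableAt_const _) hw)

/-- The boundary values of `transferFn x` on the upper (`s = 1`) and lower (`s = -1`) side of the
cut, at the point `-l`. -/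
noncomputable def cutValue (x s l : ℝ) : ℂ :=
  transferOfSqrt |x| (√l * Complex.exp (s * (Real.pi * I / 2)))

theorem jumpFn_eq (x l : ℝ) : jumpFn x l = cutValue x (-1) l - cutValue x 1 l := by
  simp only [jumpFn, cutValue, ofReal_neg, ofReal_one, one_mul, neg_mul, neg_div]

/-- The logarithm tends to `log(-t) ± πi` from the two sides of the cut; halving and exponentiating
gives the two values of the root. -/
theorem tendsto_transferFn_cut (x : ℝ) {s t : ℝ} (hs : s = 1 ∨ s = -1) (ht : t < 0) :
    Tendsto (fun ε : ℝ => transferFn x (t + s * ε * I)) (𝓝[>] 0) (𝓝 (cutValue x s (-t))) := by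
  have hre : (t : ℂ).re < 0 := by simpa using ht
  have hlin : ∀ s : ℝ, Tendsto (fun ε : ℝ => (t : ℂ) + s * ε * I) (𝓝[>] 0) (𝓝 (t : ℂ)) := by
    intro s
    have : ContinuousAt (fun ε : ℝ => (t : ℂ) + s * ε * I) 0 := by fun_prop
    have h := this.tendsto
    simp only [ofReal_zero, mul_zero, zero_mul, add_zero] at h
    exact h.mono_left nhdsWithin_le_nhds
  have hlog : Tendsto (fun ε : ℝ => log (t + s * ε * I)) (𝓝[>] 0)
      (𝓝 (Real.log (-t) + s * (Real.pi * I))) := by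
    rcases hs with rfl | rfl
    · have h1 := tendsto_log_nhdsWithin_im_nonneg_of_re_neg_of_im_zero hre (ofReal_im t)
      rw [norm_real, Real.norm_of_nonpos ht.le] at h1
      simp only [ofReal_one, one_mul]
      refine h1.comp (tendsto_nhdsWithin_iff.2 ⟨by simpa using hlin 1, ?_⟩)
      filter_upwards [self_mem_nhdsWithin] with ε hε
      have hε : 0 < ε := hε
      simp [hε.le]
    · have h1 := tendsto_log_nhdsWithin_im_neg_of_re_neg_of_im_zero hre (ofReal_im t)
      rw [norm_real, Real.norm_of_nonpos ht.le] at h1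
      rw [ofReal_neg, ofReal_one, neg_one_mul, ← sub_eq_add_neg]
      refine h1.comp (tendsto_nhdsWithin_iff.2 ⟨by simpa using hlin (-1), ?_⟩)
      filter_upwards [self_mem_nhdsWithin] with ε hε
      have hε : 0 < ε := hε
      simp [hε]
  have hval : Complex.exp ((Real.log (-t) + s * (Real.pi * I)) * (1 / 2)) =
      √(-t) * Complex.exp (s * (Real.pi * I / 2)) := by
    rw [show ((Real.log (-t) : ℂ) + s * (Real.pi * I)) * (1 / 2) =
      ((Real.log (-t) * (1 / 2) : ℝ) : ℂ) + s * (Real.pi * I / 2) by push_cast; ring,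
      Complex.exp_add, ← ofReal_exp, ← Real.rpow_def_of_pos (neg_pos.2 ht), ← Real.sqrt_eq_rpow]
  have hne : (√(-t) : ℂ) * Complex.exp (s * (Real.pi * I / 2)) ≠ 0 :=
    mul_ne_zero (ofReal_ne_zero.2 (Real.sqrt_pos.2 (neg_pos.2 ht)).ne') (Complex.exp_ne_zero _)
  have hpow : Tendsto (fun ε : ℝ => ((t : ℂ) + s * ε * I) ^ (1 / 2 : ℂ)) (𝓝[>] 0)
      (𝓝 (√(-t) * Complex.exp (s * (Real.pi * I / 2)))) := by
    rw [← hval]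
    refine ((continuous_exp.tendsto _).comp (hlog.mul_const (1 / 2))).congr fun ε => ?_
    rw [Function.comp_apply, cpow_def_of_ne_zero]
    intro h
    have := congrArg re h
    simp at this
    exact ht.ne this
  exact (transferOfSqrt_differentiableAt |x| hne).continuousAt.tendsto.comp hpow

theorem norm_cutValue_le (x : ℝ) {s t ξ : ℝ} (hs : s = 1 ∨ s = -1) (ht : 0 < t) (hξ : t ≤ ξ) :
    ‖cutValue x s t‖ ≤ Real.exp (|x| * √(ξ / 2)) / √t := by
  have h0 : 0 ≤ ξ := ht.le.trans hξ
  rw [cutValue, norm_transferOfSqrt]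
  have h1 : ‖(√t : ℂ) * Complex.exp (s * (Real.pi * I / 2))‖ = √t := by
    rw [norm_mul, norm_real, Real.norm_of_nonneg (Real.sqrt_nonneg _),
      show (s : ℂ) * (Real.pi * I / 2) = ((s * (Real.pi / 2) : ℝ) : ℂ) * I by push_cast; ring,
      norm_exp_ofReal_mul_I, mul_one]
  have h2 : Complex.exp (s * (Real.pi * I / 2)) = s * I := by
    have h3 : Complex.exp (Real.pi * I / 2) = I := by
      rw [show (Real.pi : ℂ) * I / 2 = Real.pi / 2 * I by ring, exp_pi_div_two_mul_I]
    rcases hs with rfl | rfl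
    · simp [h3]
    · rw [ofReal_neg, ofReal_one, neg_one_mul, Complex.exp_neg, h3, inv_I, neg_one_mul]
  rw [h1, ← div_div]
  refine div_le_div_of_nonneg_right ((div_le_self (Real.exp_pos _).le one_le_two).trans ?_)
    (Real.sqrt_nonneg _)
  refine Real.exp_le_exp.2 ?_
  rw [h2, re_exp_neg_pi_mul_I_div_four_mul]
  have h4 : ((√t : ℂ) * (s * I)).re + ((√t : ℂ) * (s * I)).im = s * √t := by
    simp [mul_comm]
  rw [h4, neg_mul, ← mul_neg]
  refine mul_le_mul_of_nonneg_left ?_ (abs_nonneg x)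
  have h5 : √2 / 2 * √t ≤ √(ξ / 2) := by
    rw [← sqrt_two_div_two_mul_sqrt]
    gcongr
  have h6 : 0 ≤ √2 / 2 * √t := by positivity
  rcases hs with rfl | rfl <;> linarith

theorem measurable_transferOfSqrt (d : ℝ) : Measurable (transferOfSqrt d) := by
  unfold transferOfSqrt
  fun_prop

theorem measurable_transferFn (x : ℝ) : Measurable (transferFn x) := by
  unfold transferFn
  exact (measurable_transferOfSqrt _).comp (by fun_prop)

theorem measurable_cutValue (x s : ℝ) : Measurable (cutValue x s) := by
  unfold cutValue
  exact (measurable_transferOfSqrt _).comp (by fun_prop)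

theorem measurable_jumpFn (x : ℝ) : Measurable (jumpFn x) := by
  simp_rw [funext (jumpFn_eq x)]
  exact (measurable_cutValue _ _).sub (measurable_cutValue _ _)

end TransferFunction

/-! ### The transfer function as a sum of three Cauchy transforms. -/

section CauchyRepresentation

/-- The upper (`s = 1`) or lower (`s = -1`) half of the line `Re w = -ξ`. -/
noncomputable def verticalLine (ξ s y : ℝ) : ℂ := -(ξ : ℂ) + I * s * y

theorem verticalLine_re (ξ s y : ℝ) : (verticalLine ξ s y).re = -ξ := by
  simp [verticalLine]

theorem verticalLine_im (ξ s y : ℝ) : (verticalLine ξ s y).im = s * y := by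
  simp [verticalLine]

theorem continuous_verticalLine (ξ s : ℝ) : Continuous (verticalLine ξ s) := by
  unfold verticalLine
  fun_prop

theorem norm_verticalLine {ξ s y : ℝ} (hs : s = 1 ∨ s = -1) :
    ‖verticalLine ξ s y‖ = √(ξ ^ 2 + y ^ 2) := by
  rw [Complex.norm_def, normSq_apply, verticalLine_re, verticalLine_im]
  congr 1
  rcases hs with rfl | rfl <;> ring

theorem le_norm_verticalLine {ξ s y : ℝ} (hs : s = 1 ∨ s = -1) :
    y ≤ ‖verticalLine ξ s y‖ := by
  rw [norm_verticalLine hs]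
  exact Real.le_sqrt_of_sq_le (by nlinarith [sq_nonneg ξ])

theorem sqrt_norm_div_le_decayBound {C t : ℝ} {w : ℂ} (hC : 0 ≤ C) (ht : 0 < t) (h : t ≤ ‖w‖) :
    C / √‖w‖ / (1 + ‖w‖) ≤ C * decayBound t := by
  have := decayBound_anti (s := t) (t := ‖w‖) ht.ne' (by rwa [abs_of_pos ht, abs_norm])
  rw [decayBound, abs_norm] at this
  rw [div_div, div_eq_mul_inv]
  exact mul_le_mul_of_nonneg_left this hC

/-- Here `|K(w)|` is at most a multiple of `|w|^(-1/2)`, so dividing by `1 + |w|` leaves the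
integrable `decayBound`. The factor `-1/(2π)` is `1/(2πi)` times `dw/dy`, up to the orientation of
the half-line. -/
theorem cauchyDatum_verticalLine (x : ℝ) {ξ s : ℝ} (hξ : 0 ≤ ξ) (hs : s = 1 ∨ s = -1) :
    CauchyDatum (volume.restrict (Ioi 0)) (verticalLine ξ s)
      (fun y => -(transferFn x (verticalLine ξ s y)) / (2 * Real.pi)) where
  measurable_curve := (continuous_verticalLine ξ s).aestronglyMeasurable
  measurable_density := (((measurable_transferFn x).comp
    (continuous_verticalLine ξ s).measurable).neg.div_const _).aestronglyMeasurable
  re_nonpos := Eventually.of_forall fun y => by rw [verticalLine_re]; linarith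
  integrable := by
    have hm : Measurable fun y => ‖-(transferFn x (verticalLine ξ s y)) / (2 * Real.pi : ℂ)‖ /
        (1 + ‖verticalLine ξ s y‖) :=
      (((measurable_transferFn x).comp (continuous_verticalLine ξ s).measurable).neg.div_const
        _).norm.div ((continuous_verticalLine ξ s).norm.measurable.const_add 1)
    refine (integrable_decayBound.const_mul (Real.exp (|x| * √(ξ / 2)))).integrableOn.mono'
      hm.aestronglyMeasurable ?_
    filter_upwards [ae_restrict_mem measurableSet_Ioi] with y hy
    rw [Real.norm_of_nonneg (by positivity), norm_div, norm_neg]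
    have h1 := norm_transferFn_le x hξ (verticalLine_re ξ s y).ge
    have h2 : (1 : ℝ) ≤ ‖(2 * Real.pi : ℂ)‖ := by
      rw [norm_mul, norm_real, Real.norm_of_nonneg Real.pi_pos.le, RCLike.norm_ofNat]
      linarith [Real.pi_gt_three]
    refine le_trans ?_ (sqrt_norm_div_le_decayBound (Real.exp_pos _).le hy
      (le_norm_verticalLine (ξ := ξ) hs))
    exact div_le_div_of_nonneg_right ((div_le_self (norm_nonneg _) h2).trans h1) (by positivity)

theorem cauchyDatum_cut (x : ℝ) (ξ : ℝ) :
    CauchyDatum (volume.restrict (Ioc 0 ξ)) (fun l : ℝ => -(l : ℂ))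
      (fun l => -(jumpFn x l) / (2 * Real.pi * I)) where
  measurable_curve := (by fun_prop : Measurable fun l : ℝ => -(l : ℂ)).aestronglyMeasurable
  measurable_density := ((measurable_jumpFn x).neg.div_const _).aestronglyMeasurable
  re_nonpos := by
    filter_upwards [ae_restrict_mem measurableSet_Ioc] with l hl
    simpa using hl.1.le
  integrable := by
    have hm : Measurable fun l : ℝ => ‖-(jumpFn x l) / (2 * Real.pi * I)‖ / (1 + ‖-(l : ℂ)‖) :=
      ((measurable_jumpFn x).neg.div_const _).norm.div (by fun_prop)
    refine (integrable_decayBound.const_mul (Real.exp (|x| * √(ξ / 2)))).integrableOn.mono'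
      hm.aestronglyMeasurable ?_
    filter_upwards [ae_restrict_mem measurableSet_Ioc] with l hl
    have hl0 : 0 < l := hl.1
    have hn : ‖-(l : ℂ)‖ = l := by rw [norm_neg, norm_real, Real.norm_of_nonneg hl0.le]
    rw [Real.norm_of_nonneg (by positivity), norm_div, norm_neg, jumpFn_eq]
    have h1 : ‖cutValue x (-1) l - cutValue x 1 l‖ ≤
        2 * (Real.exp (|x| * √(ξ / 2)) / √l) := by
      refine (norm_sub_le _ _).trans ?_
      rw [two_mul]
      exact add_le_add (norm_cutValue_le x (Or.inr rfl) hl0 hl.2)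
        (norm_cutValue_le x (Or.inl rfl) hl0 hl.2)
    have h2 : ‖(2 * Real.pi * I : ℂ)‖ = 2 * Real.pi := by
      rw [norm_mul, norm_mul, norm_real, Real.norm_of_nonneg Real.pi_pos.le, RCLike.norm_ofNat,
        norm_I, mul_one]
    refine le_trans ?_ (sqrt_norm_div_le_decayBound (w := -(l : ℂ)) (Real.exp_pos _).le hl0 hn.ge)
    rw [hn, h2]
    refine div_le_div_of_nonneg_right ?_ (by positivity)
    rw [div_le_iff₀ (by positivity)]
    refine h1.trans ?_
    rw [mul_comm]
    refine mul_le_mul_of_nonneg_left ?_ (by positivity)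
    linarith [Real.pi_gt_three]

theorem integral_inv_sq_add_sub_sq {A : ℝ} (hA : 0 < A) (b : ℝ) :
    Integrable (fun y : ℝ => (A ^ 2 + (y - b) ^ 2)⁻¹) ∧
      ∫ y : ℝ, (A ^ 2 + (y - b) ^ 2)⁻¹ = Real.pi / A := by
  have h : ∀ y : ℝ, (A ^ 2 + y ^ 2)⁻¹ = (A ^ 2)⁻¹ * (1 + (A⁻¹ * y) ^ 2)⁻¹ := by
    intro y
    rw [← mul_inv]
    congr 1
    field_simp
  have hi : Integrable fun y : ℝ => (A ^ 2 + y ^ 2)⁻¹ := by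
    simp_rw [h]
    exact (integrable_inv_one_add_sq.comp_mul_left' (inv_ne_zero hA.ne')).const_mul _
  refine ⟨hi.comp_sub_right b, ?_⟩
  rw [integral_sub_right_eq_self (fun y : ℝ => (A ^ 2 + y ^ 2)⁻¹)]
  simp_rw [h]
  rw [integral_const_mul, Measure.integral_comp_mul_left (fun y : ℝ => (1 + y ^ 2)⁻¹) A⁻¹,
    integral_univ_inv_one_add_sq, inv_inv, abs_of_pos hA, smul_eq_mul]
  field_simp

/-- The singularity at `z` of `transferFn x w / (w - z)` is removed by
subtracting a rational function of `w` with the same residue, whose other pole is the mirror image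
of `z` in the line `Re w = -ξ`. -/
noncomputable def regularized (x ξ : ℝ) (z w : ℂ) : ℂ :=
  transferFn x w - transferFn x z * (2 * (ξ + z.re)) / (w + (2 * ξ + (starRingEnd ℂ) z))

section

variable {x ξ : ℝ} {z : ℂ}

theorem add_reflection_re (w : ℂ) : (w + (2 * ξ + (starRingEnd ℂ) z)).re = w.re + 2 * ξ + z.re := by
  simp
  ring

theorem regularized_self (hξ : 0 < ξ) (hz : 0 < z.re) : regularized x ξ z z = 0 := by
  have h : z + (2 * ξ + (starRingEnd ℂ) z) = 2 * (ξ + z.re) := by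
    have := Complex.add_conj z
    push_cast at this
    linear_combination this
  have h0 : (2 * (ξ + z.re) : ℂ) ≠ 0 := by
    exact_mod_cast (by positivity : 2 * (ξ + z.re) ≠ 0)
  rw [regularized, h, mul_div_cancel_right₀ _ h0, sub_self]

theorem regularized_differentiableAt (hξ : 0 < ξ) {w : ℂ} (hw : w ∈ slitPlane)
    (hre : -ξ - z.re < w.re) : DifferentiableAt ℂ (regularized x ξ z) w := by
  have h : w + (2 * ξ + (starRingEnd ℂ) z) ≠ 0 := by
    intro h
    have := congrArg re h
    rw [add_reflection_re, zero_re] at this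
    linarith
  unfold regularized
  exact (transferFn_differentiableAt x hw).sub
    (DifferentiableAt.div (differentiableAt_const _) (by fun_prop) h)

theorem dslope_regularized_of_ne (hξ : 0 < ξ) (hz : 0 < z.re) {w : ℂ} (h : w ≠ z) :
    dslope (regularized x ξ z) z w = regularized x ξ z w / (w - z) := by
  rw [dslope_of_ne _ h, slope_def_field, regularized_self hξ hz, sub_zero]

theorem isOpen_slit_half : IsOpen {w : ℂ | w ∈ slitPlane ∧ -ξ - z.re < w.re} :=
  isOpen_slitPlane.inter (isOpen_lt continuous_const continuous_re)

/-- The regularized function vanishes at `z`, so its difference quotient extends across `z`. The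
reflected pole has real part `-2ξ - Re z` and lies outside the region. -/
theorem dslope_regularized_differentiableOn (hξ : 0 < ξ) (hz : 0 < z.re) :
    DifferentiableOn ℂ (dslope (regularized x ξ z) z) {w | w ∈ slitPlane ∧ -ξ - z.re < w.re} := by
  refine (differentiableOn_dslope (isOpen_slit_half.mem_nhds ⟨Or.inl hz, ?_⟩)).2 fun w hw =>
    (regularized_differentiableAt hξ hw.1 hw.2).differentiableWithinAt
  linarith

/-- Compactness bounds the quotient on a disc around `z`. Off the disc the numerator is
`O(|w|^(-1/2))` and the denominator is comparable to `1 + |w|`. -/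
theorem exists_norm_dslope_regularized_le (x : ℝ) (hξ : 0 < ξ) (hz : 0 < z.re) :
    ∃ K : ℝ, 0 ≤ K ∧ ∀ w : ℂ, w ≠ 0 → -ξ ≤ w.re →
      ‖dslope (regularized x ξ z) z w‖ ≤ K * decayBound ‖w‖ := by
  set δ := z.re / 2 with hδ
  have hδ0 : 0 < δ := by positivity
  have hsub : Metric.closedBall z δ ⊆ {w | w ∈ slitPlane ∧ -ξ - z.re < w.re} := by
    intro w hw
    have h1 := (abs_re_le_norm (w - z)).trans (mem_closedBall_iff_norm.1 hw)
    rw [sub_re, abs_le] at h1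
    have : 0 < w.re := by linarith
    exact ⟨Or.inl this, by linarith⟩
  obtain ⟨C, hC⟩ := (isCompact_closedBall z δ).exists_bound_of_continuousOn
    ((dslope_regularized_differentiableOn (x := x) hξ hz).continuousOn.mono hsub)
  have hC0 : 0 ≤ C := (norm_nonneg _).trans (hC z (Metric.mem_closedBall_self hδ0.le))
  set ρ := ‖z‖ + δ with hρ
  have hρ0 : 0 < ρ := by positivity
  have hdρ : 0 < decayBound ρ := by
    unfold decayBound
    rw [abs_of_pos hρ0]
    have := Real.sqrt_pos.2 hρ0
    positivity
  set k := (1 + ‖z‖) / δ + 1 with hk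
  have hk0 : 0 ≤ k := by positivity
  set c : ℂ := -(2 * ξ + (starRingEnd ℂ) z) with hc
  have hξz : 0 < ξ + z.re := by positivity
  set k' := (1 + ‖c‖) / (ξ + z.re) + 1 with hk'
  have hk'0 : 0 ≤ k' := by positivity
  set L := ‖transferFn x z * (2 * (ξ + z.re))‖ with hL
  have hL0 : 0 ≤ L := norm_nonneg _
  set E := Real.exp (|x| * √(ξ / 2)) with hE
  have hE0 : 0 ≤ E := (Real.exp_pos _).le
  refine ⟨C / decayBound ρ + (E + L * k') * k, by positivity, fun w hw0 hw => ?_⟩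
  have hn : 0 < ‖w‖ := norm_pos_iff.2 hw0
  rw [add_mul]
  by_cases hwz : ‖w - z‖ ≤ δ
  · have h1 : ‖w‖ ≤ ρ := by
      have := norm_add_le (w - z) z
      rw [sub_add_cancel] at this
      linarith
    have h2 := decayBound_anti (s := ‖w‖) (t := ρ) hn.ne' (by rwa [abs_norm, abs_of_pos hρ0])
    have h3 : C ≤ C / decayBound ρ * decayBound ‖w‖ := by
      rw [div_mul_eq_mul_div, le_div_iff₀ hdρ]
      gcongr
    have h4 : 0 ≤ (E + L * k') * k * decayBound ‖w‖ :=
      mul_nonneg (by positivity) (decayBound_nonneg _)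
    linarith [hC w (mem_closedBall_iff_norm.2 hwz)]
  · push Not at hwz
    have hne : w ≠ z := by
      rintro rfl
      simp at hwz
      linarith
    have h1 := one_add_norm_le_mul_norm_sub hδ0 hwz.le
    have h2 : ξ + z.re ≤ ‖w - c‖ := by
      have h3 := (le_abs_self _).trans (abs_re_le_norm (w - c))
      rw [hc, sub_neg_eq_add, add_reflection_re] at h3
      rw [hc, sub_neg_eq_add]
      linarith
    have h3 := one_add_norm_le_mul_norm_sub hξz h2
    have hsq : 0 < √‖w‖ := Real.sqrt_pos.2 hn
    have hsq1 : √‖w‖ ≤ 1 + ‖w‖ :=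
      Real.sqrt_le_iff.2 ⟨by positivity, by nlinarith⟩
    have h4 : ‖regularized x ξ z w‖ ≤ (E + L * k') / √‖w‖ := by
      rw [regularized, add_div]
      refine (norm_sub_le _ _).trans (add_le_add (norm_transferFn_le x hξ.le hw) ?_)
      rw [norm_div, show w + (2 * ξ + (starRingEnd ℂ) z) = w - c by rw [hc, sub_neg_eq_add],
        div_le_div_iff₀ (hξz.trans_le h2) hsq, mul_assoc]
      exact mul_le_mul_of_nonneg_left (hsq1.trans h3) hL0
    have h5 : 0 ≤ C / decayBound ρ * decayBound ‖w‖ :=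
      mul_nonneg (by positivity) (decayBound_nonneg _)
    refine le_trans ?_ (le_add_of_nonneg_left h5)
    rw [dslope_regularized_of_ne hξ hz hne, norm_div, decayBound, abs_norm, mul_inv]
    have h6 : 1 / ‖w - z‖ ≤ k * (1 + ‖w‖)⁻¹ := by
      rw [← div_eq_mul_inv, div_le_div_iff₀ (hδ0.trans hwz) (by positivity), one_mul]
      exact h1
    calc _ = ‖regularized x ξ z w‖ * (1 / ‖w - z‖) := by ring
      _ ≤ (E + L * k') / √‖w‖ * (k * (1 + ‖w‖)⁻¹) := by gcongr
      _ = _ := by ring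

/-- The boundary values of the regularized Cauchy kernel on the real axis. -/
noncomputable def boundaryKernel (x ξ : ℝ) (z : ℂ) (s t : ℝ) : ℂ :=
  if t < 0 then (cutValue x s (-t) -
    transferFn x z * (2 * (ξ + z.re)) / (t + (2 * ξ + (starRingEnd ℂ) z))) / (t - z)
  else dslope (regularized x ξ z) z t

theorem tendsto_boundaryKernel (hξ : 0 < ξ) (hz : 0 < z.re) {s t : ℝ} (hs : s = 1 ∨ s = -1)
    (htξ : -ξ < t) (ht : t ≠ 0) :
    Tendsto (fun ε : ℝ => dslope (regularized x ξ z) z (t + s * ε * I)) (𝓝[>] 0)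
      (𝓝 (boundaryKernel x ξ z s t)) := by
  have hlin : Tendsto (fun ε : ℝ => (t : ℂ) + s * ε * I) (𝓝[>] 0) (𝓝 (t : ℂ)) := by
    have : ContinuousAt (fun ε : ℝ => (t : ℂ) + s * ε * I) 0 := by fun_prop
    have h := this.tendsto
    simp only [ofReal_zero, mul_zero, zero_mul, add_zero] at h
    exact h.mono_left nhdsWithin_le_nhds
  rcases lt_or_gt_of_ne ht with h | h
  · rw [boundaryKernel, if_pos h]
    have h1 : (t : ℂ) + (2 * ξ + (starRingEnd ℂ) z) ≠ 0 := by
      intro h0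
      have := congrArg re h0
      rw [add_reflection_re, zero_re, ofReal_re] at this
      linarith
    have h2 : (t : ℂ) - z ≠ 0 := by
      intro h0
      have := congrArg re h0
      rw [sub_re, ofReal_re, zero_re] at this
      linarith
    refine ((((tendsto_transferFn_cut x hs h).sub
      (Tendsto.div tendsto_const_nhds (hlin.add_const _) h1)).div
      (hlin.sub_const z) h2)).congr fun ε => ?_
    rw [dslope_regularized_of_ne hξ hz, regularized]
    · rfl
    · intro h0
      have := congrArg re h0
      simp at this
      linarith
  · rw [boundaryKernel, if_neg (not_lt.2 h.le)]
    have hmem : (t : ℂ) ∈ {w : ℂ | w ∈ slitPlane ∧ -ξ - z.re < w.re} :=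
      ⟨Or.inl (by simpa using h), by simp; linarith⟩
    exact ((dslope_regularized_differentiableOn hξ hz).continuousOn.continuousAt
      (isOpen_slit_half.mem_nhds hmem)).tendsto.comp hlin

theorem integral_boundaryKernel (x : ℝ) (hξ : 0 < ξ) (hz : 0 < z.re) {s : ℝ}
    (hs : s = 1 ∨ s = -1) :
    IntegrableOn (boundaryKernel x ξ z s) (Ioi (-ξ)) ∧
      ∫ t in Ioi (-ξ), boundaryKernel x ξ z s t =
        s * I * ∫ y in Ioi (0 : ℝ), dslope (regularized x ξ z) z (verticalLine ξ s y) := by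
  obtain ⟨K, hK0, hK⟩ := exists_norm_dslope_regularized_le x hξ hz
  have := integral_quadrant (G := dslope (regularized x ξ z) z) hs hξ hK0
    ((dslope_regularized_differentiableOn hξ hz).mono fun w hw => ⟨Or.inr ?_, ?_⟩)
    (fun w hw1 hw2 => hK w (by rintro rfl; simp at hw2) hw1)
    (fun t h1 h2 => tendsto_boundaryKernel hξ hz hs h1 h2)
  · refine ⟨this.1, this.2.2.trans ?_⟩
    congr 3
    ext y
    rw [verticalLine]
    congr 1
    ring
  · intro h0
    have := hw.2
    rw [h0, mul_zero] at this
    exact lt_irrefl _ this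
  · have := hw.1
    linarith

/-- On the line, the product of `w - z` and `w + 2ξ + conj z` is real and the subtracted term
becomes a multiple of the Poisson kernel of `z`. Its total mass supplies `2π K(z)`, in place of a
residue computation. -/
theorem integral_dslope_verticalLine (x : ℝ) (hξ : 0 < ξ) (hz : 0 < z.re) :
    (∫ y in Ioi (0 : ℝ), dslope (regularized x ξ z) z (verticalLine ξ 1 y)) +
      ∫ y in Ioi (0 : ℝ), dslope (regularized x ξ z) z (verticalLine ξ (-1) y) =
    (∫ y in Ioi (0 : ℝ), transferFn x (verticalLine ξ 1 y) / (verticalLine ξ 1 y - z)) +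
      (∫ y in Ioi (0 : ℝ), transferFn x (verticalLine ξ (-1) y) / (verticalLine ξ (-1) y - z)) +
      2 * Real.pi * transferFn x z := by
  have hA : 0 < ξ + z.re := by positivity
  obtain ⟨hi, hv⟩ := integral_inv_sq_add_sub_sq hA z.im
  set Q : ℝ → ℂ := fun y => (((ξ + z.re) ^ 2 + (y - z.im) ^ 2)⁻¹ : ℝ) with hQ
  have hQi : Integrable Q := hi.ofReal
  have hQv : ∫ y, Q y = Real.pi / (ξ + z.re) :=
    integral_complex_ofReal.trans (by rw [hv]; push_cast; rfl)
  set k : ℂ := transferFn x z * (2 * (ξ + z.re)) with hk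
  have hpt : ∀ {s : ℝ}, s = 1 ∨ s = -1 → ∀ y : ℝ,
      dslope (regularized x ξ z) z (verticalLine ξ s y) =
        transferFn x (verticalLine ξ s y) / (verticalLine ξ s y - z) + k * Q (s * y) := by
    intro s hs y
    have hne : verticalLine ξ s y ≠ z := by
      intro h
      have := congrArg re h
      rw [verticalLine_re] at this
      linarith
    rw [dslope_regularized_of_ne hξ hz hne, regularized, ← hk, sub_div, sub_eq_add_neg, div_div,
      ← mul_neg_one, div_mul_eq_mul_div, mul_div_assoc]
    congr 2
    have hz' : z = z.re + z.im * I := (re_add_im z).symm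
    have hc : (starRingEnd ℂ) z = z.re - z.im * I := by
      apply Complex.ext <;> simp
    have hprod : (verticalLine ξ s y + (2 * ξ + (starRingEnd ℂ) z)) * (verticalLine ξ s y - z) =
        -(((ξ + z.re) ^ 2 + (s * y - z.im) ^ 2 : ℝ) : ℂ) := by
      rw [hc]
      conv_lhs => enter [2, 2]; rw [hz']
      rw [verticalLine]
      push_cast
      linear_combination ((s : ℂ) * y - z.im) ^ 2 * I_sq
    rw [hprod, neg_div_neg_eq, hQ]
    push_cast
    rw [one_div]
  have hint : ∀ {s : ℝ}, s = 1 ∨ s = -1 → IntegrableOn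
      (fun y => transferFn x (verticalLine ξ s y) / (verticalLine ξ s y - z)) (Ioi 0) := by
    intro s hs
    have h1 := ((cauchyDatum_verticalLine x hξ.le hs).integrable_div hz).const_mul
      (-(2 * Real.pi : ℂ))
    refine h1.congr (Eventually.of_forall fun y => ?_)
    have : (Real.pi : ℂ) ≠ 0 := ofReal_ne_zero.2 Real.pi_ne_zero
    field_simp
  have h1 : IntegrableOn (fun y => k * Q (1 * y)) (Ioi 0) := by
    simpa using (hQi.const_mul k).integrableOn
  have h2 : IntegrableOn (fun y => k * Q (-1 * y)) (Ioi 0) := by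
    simpa using ((hQi.const_mul k).comp_neg).integrableOn
  simp_rw [hpt (Or.inl rfl), hpt (Or.inr rfl)]
  rw [integral_add (hint (Or.inl rfl)) h1, integral_add (hint (Or.inr rfl)) h2,
    integral_const_mul, integral_const_mul]
  have h3 : (∫ y in Ioi (0 : ℝ), Q (1 * y)) + ∫ y in Ioi (0 : ℝ), Q (-1 * y) =
      Real.pi / (ξ + z.re) := by
    simp_rw [one_mul, neg_one_mul]
    rw [integral_comp_neg_Ioi, neg_zero, add_comm,
      intervalIntegral.integral_Iic_add_Ioi hQi.integrableOn hQi.integrableOn, hQv]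
  have h4 : k * (Real.pi / (ξ + z.re)) = 2 * Real.pi * transferFn x z := by
    have : (ξ + z.re : ℂ) ≠ 0 := by exact_mod_cast hA.ne'
    rw [hk]
    field_simp
  linear_combination k * h3 + h4

/-- Cauchy's integral formula for the transfer function, with the contour deformed to the line
`Re w = -ξ` and the two sides of the cut. -/
theorem transferFn_eq_integral (x : ℝ) (hξ : 0 < ξ) (hz : 0 < z.re) :
    transferFn x z =
      (∫ l in Ioc 0 ξ, -(jumpFn x l) / (2 * Real.pi * I) / (-(l : ℂ) - z)) +
      (∫ y in Ioi (0 : ℝ), -(transferFn x (verticalLine ξ 1 y)) / (2 * Real.pi) /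
        (verticalLine ξ 1 y - z)) +
      ∫ y in Ioi (0 : ℝ), -(transferFn x (verticalLine ξ (-1) y)) / (2 * Real.pi) /
        (verticalLine ξ (-1) y - z) := by
  obtain ⟨i1, e1⟩ := integral_boundaryKernel x hξ hz (s := 1) (Or.inl rfl)
  obtain ⟨i2, e2⟩ := integral_boundaryKernel x hξ hz (s := -1) (Or.inr rfl)
  have e3 := integral_dslope_verticalLine x hξ hz
  -- In the difference of the two quadrants the positive axis cancels, as does the rational term,
  -- which has no cut. Only the jump survives, with a minus sign since `jumpFn` is lower minus upper
  -- value.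
  have e4 : ∫ t in Ioi (-ξ), (boundaryKernel x ξ z 1 t - boundaryKernel x ξ z (-1) t) =
      ∫ l in Ioc 0 ξ, -(jumpFn x l) / (-(l : ℂ) - z) := by
    have h1 : ∀ t : ℝ, boundaryKernel x ξ z 1 t - boundaryKernel x ξ z (-1) t =
        (Iio 0).indicator (fun t : ℝ => -(jumpFn x (-t)) / (t - z)) t := by
      intro t
      by_cases ht : t < 0
      · rw [indicator_of_mem (show t ∈ Iio 0 from ht), boundaryKernel, boundaryKernel, if_pos ht,
          if_pos ht, jumpFn_eq]
        ring
      · rw [indicator_of_notMem (show t ∉ Iio 0 from ht), boundaryKernel, boundaryKernel, if_neg ht,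
          if_neg ht, sub_self]
    simp_rw [h1]
    rw [setIntegral_indicator measurableSet_Iio, Ioi_inter_Iio, ← integral_Ioc_eq_integral_Ioo,
      ← intervalIntegral.integral_of_le (by linarith), ← intervalIntegral.integral_of_le hξ.le]
    have := intervalIntegral.integral_comp_neg (a := 0) (b := ξ)
      (fun t : ℝ => -(jumpFn x (-t)) / ((t : ℂ) - z))
    rw [neg_zero] at this
    rw [← this]
    simp
  rw [integral_sub i1 i2, e1, e2] at e4
  have hpi : (Real.pi : ℂ) ≠ 0 := ofReal_ne_zero.2 Real.pi_ne_zero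
  have f1 : ∫ l in Ioc 0 ξ, -(jumpFn x l) / (2 * Real.pi * I) / (-(l : ℂ) - z) =
      (2 * Real.pi * I)⁻¹ * ∫ l in Ioc 0 ξ, -(jumpFn x l) / (-(l : ℂ) - z) := by
    rw [← integral_const_mul]
    congr 1
    ext l
    ring
  have f2 : ∀ s : ℝ, ∫ y in Ioi (0 : ℝ), -(transferFn x (verticalLine ξ s y)) / (2 * Real.pi) /
        (verticalLine ξ s y - z) =
      -(2 * Real.pi : ℂ)⁻¹ *
        ∫ y in Ioi (0 : ℝ), transferFn x (verticalLine ξ s y) / (verticalLine ξ s y - z) := by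
    intro s
    rw [← integral_const_mul]
    congr 1
    ext y
    ring
  rw [f1, f2, f2, ← e4]
  have hI := I_ne_zero
  push_cast
  field_simp
  linear_combination -e3

end

end CauchyRepresentation

/-! ### Taylor coefficients, and entries of inverse matrices. -/

theorem iteratedDeriv_div_factorial_of_hasSum {f : ℂ → ℂ} {c : ℕ → ℂ}
    (hf : ∀ ζ : ℂ, ‖ζ‖ < 1 → HasSum (fun n => c n * ζ ^ n) (f ζ)) (n : ℕ) :
    iteratedDeriv n f 0 / (n.factorial : ℂ) = c n := by
  have h : HasFPowerSeriesOnBall f (.ofScalars ℂ c) 0 1 := by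
    constructor
    · refine le_of_forall_lt_imp_le_of_dense fun r hr => ?_
      lift r to NNReal using hr.ne_top
      apply FormalMultilinearSeries.le_radius_of_summable
      have hr' : ‖((r : ℝ) : ℂ)‖ < 1 := by simpa using hr
      simpa [smul_eq_mul, norm_mul, mul_comm, mul_left_comm, mul_assoc] using
        (hf _ hr').summable.norm
    · simp
    · intro y hy
      rw [← ENNReal.coe_one, Metric.eball_coe, NNReal.coe_one, mem_ball_zero_iff] at hy
      simpa [mul_comm] using hf y hy
  have h1 := h.hasFPowerSeriesAt.eq_formalMultilinearSeries
    h.hasFPowerSeriesAt.analyticAt.hasFPowerSeriesAt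
  have h2 := congrArg (fun p : FormalMultilinearSeries ℂ ℂ ℂ => p.coeff n) h1
  simp only [FormalMultilinearSeries.coeff_ofScalars] at h2
  exact h2.symm

section MatrixEntries

variable {ι : Type*} [Fintype ι] [DecidableEq ι]

theorem inv_apply_eq (F : Matrix ι ι ℂ) (i j : ι) : F⁻¹ i j = F.det⁻¹ * F.adjugate i j := by
  rw [Matrix.inv_def, Ring.inverse_eq_inv', Matrix.smul_apply, smul_eq_mul]

theorem measurable_inv_apply {F : ℂ → Matrix ι ι ℂ} (hF : Continuous F) (i j : ι) :
    Measurable fun z => (F z)⁻¹ i j := by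
  simp_rw [inv_apply_eq]
  exact hF.matrix_det.measurable.inv.mul (hF.matrix_adjugate.matrix_elem i j).measurable

theorem continuousOn_inv_apply {F : ℂ → Matrix ι ι ℂ} (hF : Continuous F) {S : Set ℂ}
    (hS : ∀ z ∈ S, IsUnit (F z)) (i j : ι) : ContinuousOn (fun z => (F z)⁻¹ i j) S := by
  simp_rw [inv_apply_eq]
  refine ContinuousOn.mul (hF.matrix_det.continuousOn.inv₀ fun z hz => ?_)
    (hF.matrix_adjugate.matrix_elem i j).continuousOn
  exact ((Matrix.isUnit_iff_isUnit_det _).1 (hS z hz)).ne_zero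

theorem exists_norm_inv_apply_le {F : ℂ → Matrix ι ι ℂ} (hF : Continuous F)
    (hS : ∀ z : ℂ, z.re ≤ 0 → IsUnit (F z)) :
    ∃ C : ℝ, 0 ≤ C ∧ ∀ z : ℂ, z.re ≤ 0 → ‖z‖ ≤ 1 → ∀ i j, ‖(F z)⁻¹ i j‖ ≤ C := by
  have hc : IsCompact ({z : ℂ | z.re ≤ 0} ∩ Metric.closedBall 0 1) :=
    (isCompact_closedBall 0 1).inter_left (isClosed_le continuous_re continuous_const)
  choose C hC using fun i j => hc.exists_bound_of_continuousOn
    ((continuousOn_inv_apply hF hS i j).mono inter_subset_left)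
  refine ⟨∑ i, ∑ j, |C i j|, Finset.sum_nonneg fun _ _ => Finset.sum_nonneg fun _ _ =>
    abs_nonneg _, fun z hz hz1 i j => ?_⟩
  calc ‖(F z)⁻¹ i j‖ ≤ |C i j| := (hC i j z ⟨hz, by simpa using hz1⟩).trans (le_abs_self _)
    _ ≤ ∑ j, |C i j| :=
      Finset.single_le_sum (f := fun j => |C i j|) (fun _ _ => abs_nonneg _) (Finset.mem_univ j)
    _ ≤ ∑ i, ∑ j, |C i j| :=
      Finset.single_le_sum (f := fun i => ∑ j, |C i j|)
        (fun _ _ => Finset.sum_nonneg fun _ _ => abs_nonneg _) (Finset.mem_univ i)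

end MatrixEntries

/-! ### Algebra and decay of stiffly accurate methods. -/

namespace RungeKutta

variable {m : ℕ} {M : RungeKutta m}

namespace Admissible

theorem isUnit_Ac (hM : M.Admissible) : IsUnit M.Ac :=
  hM.invertible.map (Complex.ofRealHom.mapMatrix (m := Fin (m + 1)))

theorem isUnit_det_Ac (hM : M.Admissible) : IsUnit M.Ac.det :=
  (Matrix.isUnit_iff_isUnit_det _).1 hM.isUnit_Ac

theorem b_eq (hM : M.Admissible) : M.b = M.A (Fin.last m) := by
  have h := congrArg (fun v => Matrix.vecMul v M.A) hM.stiffly_accurate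
  simp only [Matrix.vecMul_vecMul] at h
  rw [Matrix.nonsing_inv_mul _ ((Matrix.isUnit_iff_isUnit_det _).1 hM.invertible),
    Matrix.vecMul_one, Matrix.single_one_vecMul] at h
  exact h

theorem bc_eq (hM : M.Admissible) : M.bc = M.Ac (Fin.last m) := by
  ext j
  rw [bc, hM.b_eq]
  rfl

theorem q_eq (hM : M.Admissible) (z : ℂ) : M.q z = (M.Ac * (1 - z • M.Ac)⁻¹) (Fin.last m) := by
  rw [q, hM.bc_eq]
  rfl

theorem isUnit_det (hM : M.Admissible) {z : ℂ} (hz : z.re ≤ 0) : IsUnit (1 - z • M.Ac).det :=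
  (Matrix.isUnit_iff_isUnit_det _).1 (hM.nonsingular z hz)

theorem one_add_mul_resolvent (hM : M.Admissible) {z : ℂ} (hz : z.re ≤ 0) :
    1 + z • (M.Ac * (1 - z • M.Ac)⁻¹) = (1 - z • M.Ac)⁻¹ := by
  have h := Matrix.mul_nonsing_inv _ (hM.isUnit_det hz)
  rw [sub_mul, one_mul, Matrix.smul_mul] at h
  exact (sub_eq_iff_eq_add.1 h).symm

/-- Stiff accuracy says `bᵀ = e_sᵀ A`, which absorbs the `1` in the definition of `r`. In this form
the decay of `r` follows from that of `(1 - zA)⁻¹`. -/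
theorem r_eq (hM : M.Admissible) {z : ℂ} (hz : z.re ≤ 0) :
    M.r z = ((1 - z • M.Ac)⁻¹).mulVec (fun _ => 1) (Fin.last m) := by
  rw [← hM.one_add_mul_resolvent hz, r, hM.q_eq, Matrix.add_mulVec, Matrix.one_mulVec, Pi.add_apply,
    Matrix.smul_mulVec]
  rfl

theorem resolvent_comm (hM : M.Admissible) {z : ℂ} (hz : z.re ≤ 0) :
    (1 - z • M.Ac)⁻¹ * M.Ac = M.Ac * (1 - z • M.Ac)⁻¹ := by
  have h1 := Matrix.mul_nonsing_inv _ (hM.isUnit_det hz)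
  have h2 := Matrix.nonsing_inv_mul _ (hM.isUnit_det hz)
  have h3 : (1 - z • M.Ac) * M.Ac = M.Ac * (1 - z • M.Ac) := by
    simp [sub_mul, mul_sub]
  calc _ = (1 - z • M.Ac)⁻¹ * (M.Ac * (1 - z • M.Ac)) * (1 - z • M.Ac)⁻¹ := by
        rw [mul_assoc, mul_assoc, h1, mul_one]
    _ = _ := by rw [← h3, ← mul_assoc, h2, one_mul]

end Admissible

/-- The rank-one matrix `𝟙 e_sᵀ`. -/
def lastColumnOnes (m : ℕ) : Matrix (Fin (m + 1)) (Fin (m + 1)) ℂ :=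
  Matrix.vecMulVec (fun _ => 1) (Pi.single (Fin.last m) 1)

theorem lastColumnOnes_mul_self : lastColumnOnes m * lastColumnOnes m = lastColumnOnes m := by
  rw [lastColumnOnes, Matrix.vecMulVec_mul_vecMulVec]
  simp

namespace Admissible

/-- With `P = 𝟙 e_sᵀ` one has `𝟙 bᵀ = P A`, so the matrix to invert is `(1 + ζ/(1-ζ) P) A`. As `P`
is idempotent, the first factor has inverse `1 - ζ P`. -/
theorem symbol_eq (hM : M.Admissible) {ζ : ℂ} (hζ : ζ ≠ 1) :
    M.symbol ζ = M.Ac⁻¹ * (1 - ζ • lastColumnOnes m) := by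
  have h1 : Matrix.vecMulVec (fun _ => 1) M.bc = lastColumnOnes m * M.Ac := by
    rw [lastColumnOnes, Matrix.vecMulVec_mul, Matrix.single_one_vecMul, hM.bc_eq]
    rfl
  have hζ' : 1 - ζ ≠ 0 := sub_ne_zero.2 hζ.symm
  have h2 : (1 + (ζ / (1 - ζ)) • lastColumnOnes m) * (1 - ζ • lastColumnOnes m) = 1 := by
    simp only [add_mul, mul_sub, mul_one, one_mul, Matrix.smul_mul, Matrix.mul_smul,
      lastColumnOnes_mul_self]
    rw [smul_smul, ← add_smul, add_sub_assoc, ← sub_smul]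
    have : ζ / (1 - ζ) - (ζ + ζ * (ζ / (1 - ζ))) = 0 := by field_simp; ring
    rw [this, zero_smul, add_zero]
  apply Matrix.inv_eq_right_inv
  rw [h1]
  calc (M.Ac + (ζ / (1 - ζ)) • (lastColumnOnes m * M.Ac)) *
        (M.Ac⁻¹ * (1 - ζ • lastColumnOnes m)) =
      (1 + (ζ / (1 - ζ)) • lastColumnOnes m) * (M.Ac * M.Ac⁻¹) * (1 - ζ • lastColumnOnes m) := by
        simp only [add_mul, one_mul, Matrix.smul_mul, mul_assoc]
    _ = 1 := by rw [Matrix.mul_nonsing_inv _ hM.isUnit_det_Ac, mul_one, h2]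

theorem resolvent_mul_ones_sq (hM : M.Admissible) {z : ℂ} (hz : z.re ≤ 0) :
    ((1 - z • M.Ac)⁻¹ * lastColumnOnes m) * ((1 - z • M.Ac)⁻¹ * lastColumnOnes m) =
      M.r z • ((1 - z • M.Ac)⁻¹ * lastColumnOnes m) := by
  rw [lastColumnOnes, Matrix.mul_vecMulVec, Matrix.vecMulVec_mul_vecMulVec, single_one_dotProduct,
    ← hM.r_eq hz, Matrix.vecMulVec_smul]

theorem one_sub_mul_r_ne_zero (hM : M.Admissible) {z ζ : ℂ} (hz : z.re ≤ 0) (hζ : ‖ζ‖ < 1) :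
    1 - ζ * M.r z ≠ 0 := by
  intro h
  have h1 : ‖ζ * M.r z‖ = 1 := by rw [← sub_eq_zero.1 h, norm_one]
  rw [norm_mul] at h1
  nlinarith [hM.norm_r_le z hz, norm_nonneg ζ, norm_nonneg (M.r z)]

/-- A Sherman–Morrison formula: with `R = (1 - zA)⁻¹`, `Δ(ζ) - z = A⁻¹ (1 - zA) (1 - ζ R P)`, where
`R P` has rank one and `(R P)² = r(z) R P`. -/
theorem symbol_sub_mul (hM : M.Admissible) {z ζ : ℂ} (hz : z.re ≤ 0) (hζ : ‖ζ‖ < 1) :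
    (M.symbol ζ - z • (1 : Matrix (Fin (m + 1)) (Fin (m + 1)) ℂ)) *
      ((1 + (ζ / (1 - ζ * M.r z)) • ((1 - z • M.Ac)⁻¹ * lastColumnOnes m)) *
        (M.Ac * (1 - z • M.Ac)⁻¹)) = 1 := by
  have hζ1 : ζ ≠ 1 := by rintro rfl; simp at hζ
  have hr := hM.one_sub_mul_r_ne_zero hz hζ
  have hA := Matrix.nonsing_inv_mul _ hM.isUnit_det_Ac
  have hR := Matrix.mul_nonsing_inv _ (hM.isUnit_det hz)
  set R := (1 - z • M.Ac)⁻¹ with hRdef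
  have h1 : M.symbol ζ - z • (1 : Matrix (Fin (m + 1)) (Fin (m + 1)) ℂ) =
      M.Ac⁻¹ * (1 - z • M.Ac) * (1 - ζ • (R * lastColumnOnes m)) := by
    rw [hM.symbol_eq hζ1]
    calc _ = M.Ac⁻¹ - ζ • (M.Ac⁻¹ * lastColumnOnes m) - z • (M.Ac⁻¹ * M.Ac) := by
          rw [hA, mul_sub, mul_one, Matrix.mul_smul]
      _ = M.Ac⁻¹ * (1 - z • M.Ac) -
          ζ • (M.Ac⁻¹ * (((1 - z • M.Ac) * R) * lastColumnOnes m)) := by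
          rw [hR, one_mul, mul_sub, mul_one, Matrix.mul_smul, sub_right_comm]
      _ = _ := by
          rw [mul_sub (M.Ac⁻¹ * (1 - z • M.Ac)), mul_one, Matrix.mul_smul]
          simp only [mul_assoc]
  have h2 : (1 - ζ • (R * lastColumnOnes m)) *
      (1 + (ζ / (1 - ζ * M.r z)) • (R * lastColumnOnes m)) = 1 := by
    have h3 := hM.resolvent_mul_ones_sq hz
    rw [← hRdef] at h3
    rw [sub_mul, one_mul, mul_add, mul_one, Matrix.smul_mul, Matrix.mul_smul, h3, smul_smul,
      smul_smul, ← add_smul, add_sub_assoc, ← sub_smul]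
    have : ζ / (1 - ζ * M.r z) - (ζ + ζ * (ζ / (1 - ζ * M.r z)) * M.r z) = 0 := by
      field_simp
      ring
    rw [this, zero_smul, add_zero]
  rw [h1, ← hM.resolvent_comm hz, ← hRdef]
  calc _ = M.Ac⁻¹ * (1 - z • M.Ac) * ((1 - ζ • (R * lastColumnOnes m)) *
      (1 + (ζ / (1 - ζ * M.r z)) • (R * lastColumnOnes m))) * (R * M.Ac) := by
        simp only [mul_assoc]
    _ = M.Ac⁻¹ * ((1 - z • M.Ac) * R) * M.Ac := by
        rw [h2, mul_one]
        simp only [mul_assoc]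
    _ = 1 := by rw [hR, mul_one, hA]

theorem symbol_resolvent_last (hM : M.Admissible) {z ζ : ℂ} (hz : z.re ≤ 0) (hζ : ‖ζ‖ < 1) :
    (M.symbol ζ - z • (1 : Matrix (Fin (m + 1)) (Fin (m + 1)) ℂ))⁻¹ (Fin.last m) =
      (1 - ζ * M.r z)⁻¹ • M.q z := by
  have hr := hM.one_sub_mul_r_ne_zero hz hζ
  rw [Matrix.inv_eq_right_inv (hM.symbol_sub_mul hz hζ)]
  have h1 : ((1 - z • M.Ac)⁻¹ * lastColumnOnes m * (M.Ac * (1 - z • M.Ac)⁻¹)) (Fin.last m) =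
      M.r z • M.q z := by
    rw [lastColumnOnes, Matrix.mul_vecMulVec, Matrix.vecMulVec_mul, Matrix.single_one_vecMul,
      hM.r_eq hz, hM.q_eq]
    rfl
  rw [add_mul, one_mul, Matrix.smul_mul]
  have h2 : ∀ B C : Matrix (Fin (m + 1)) (Fin (m + 1)) ℂ, ∀ c : ℂ,
      (B + c • C) (Fin.last m) = B (Fin.last m) + c • C (Fin.last m) := fun _ _ _ => rfl
  rw [h2, h1, ← hM.q_eq, smul_smul]
  conv_lhs => rw [← one_smul ℂ (M.q z), smul_smul, ← add_smul]
  congr 1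
  field_simp
  ring

theorem isUnit_symbol_sub (hM : M.Admissible) {z ζ : ℂ} (hz : z.re ≤ 0) (hζ : ‖ζ‖ < 1) :
    IsUnit (M.symbol ζ - z • (1 : Matrix (Fin (m + 1)) (Fin (m + 1)) ℂ)) :=
  (Matrix.isUnit_iff_isUnit_det _).2
    (Matrix.isUnit_det_of_right_inverse (hM.symbol_sub_mul hz hζ))

/-- `Δ(ζ) - z` is invertible for `Re z ≤ 0` because `|ζ r(z)| < 1`, so the spectrum keeps off the
closed left half-plane and hence off the cut. -/
theorem re_pos_of_isRoot (hM : M.Admissible) {h : ℝ} (hh : 0 < h) {ζ : ℂ} (hζ : ‖ζ‖ < 1) {μ : ℂ}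
    (hμ : ((h : ℂ)⁻¹ • M.symbol ζ).charpoly.IsRoot μ) : 0 < μ.re := by
  by_contra! hre
  have hh0 : (h : ℂ) ≠ 0 := ofReal_ne_zero.2 hh.ne'
  have hz : ((h : ℂ) * μ).re ≤ 0 := by
    rw [re_ofReal_mul]
    exact mul_nonpos_of_nonneg_of_nonpos hh.le hre
  have h1 := (Matrix.isUnit_iff_isUnit_det _).1 (hM.isUnit_symbol_sub hz hζ)
  rw [Polynomial.IsRoot.def, Matrix.eval_charpoly] at hμ
  refine h1.ne_zero ?_
  have h2 : M.symbol ζ - ((h : ℂ) * μ) • (1 : Matrix (Fin (m + 1)) (Fin (m + 1)) ℂ) =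
      (-(h : ℂ)) • (Matrix.scalar (Fin (m + 1)) μ - (h : ℂ)⁻¹ • M.symbol ζ) := by
    rw [smul_sub, smul_smul, neg_mul, mul_inv_cancel₀ hh0, neg_one_smul, sub_neg_eq_add, neg_smul,
      Matrix.scalar_apply, ← Matrix.smul_one_eq_diagonal, smul_smul]
    abel
  rw [h2, Matrix.det_smul, hμ, mul_zero]

theorem hasSum_geometric (hM : M.Admissible) {z ζ : ℂ} (hz : z.re ≤ 0) (hζ : ‖ζ‖ < 1) :
    HasSum (fun n => M.r z ^ n * ζ ^ n) (1 - ζ * M.r z)⁻¹ := by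
  have h : ‖ζ * M.r z‖ < 1 := by
    rw [norm_mul]
    nlinarith [hM.norm_r_le z hz, norm_nonneg ζ, norm_nonneg (M.r z)]
  refine (hasSum_geometric_of_norm_lt_one h).congr_fun ?_
  intro n
  rw [mul_pow, mul_comm]

theorem eVec_eq (hM : M.Admissible) (n : ℕ) {z : ℂ} (hz : z.re ≤ 0) :
    M.eVec n z = M.r z ^ n • M.q z := by
  ext j
  refine (iteratedDeriv_div_factorial_of_hasSum (c := fun n => M.r z ^ n * M.q z j)
    (fun ζ hζ => ?_) n).trans (by simp)
  change HasSum _ ((M.symbol ζ - z • (1 : Matrix (Fin (m + 1)) (Fin (m + 1)) ℂ))⁻¹ (Fin.last m) j)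
  rw [hM.symbol_resolvent_last hz hζ, Pi.smul_apply, smul_eq_mul]
  refine ((hM.hasSum_geometric hz hζ).mul_right (M.q z j)).congr_fun fun n => ?_
  ring

/-- On the unit half-disc this is compactness. Outside, `(1 - zA)⁻¹ = z⁻¹ (z⁻¹ - A)⁻¹`, and
inversion preserves the left half-plane, so compactness applies to `z⁻¹`; the limit point `z⁻¹ = 0`
is covered by invertibility of `A`. -/
theorem exists_norm_resolvent_le (hM : M.Admissible) :
    ∃ C : ℝ, 0 ≤ C ∧ ∀ z : ℂ, z.re ≤ 0 → ∀ i j, ‖(1 - z • M.Ac)⁻¹ i j‖ ≤ C / (1 + ‖z‖) := by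
  have hinv : ∀ z : ℂ, z.re ≤ 0 → z⁻¹.re ≤ 0 := by
    intro z hz
    rw [inv_re]
    exact div_nonpos_of_nonpos_of_nonneg hz (normSq_nonneg z)
  have hfac : ∀ z : ℂ, z ≠ 0 → 1 - z • M.Ac = z • (z⁻¹ • 1 - M.Ac) := by
    intro z hz
    rw [smul_sub, smul_smul, mul_inv_cancel₀ hz, one_smul]
  obtain ⟨C₁, h1, hC₁⟩ := exists_norm_inv_apply_le (F := fun z => 1 - z • M.Ac)
    (by fun_prop) hM.nonsingular
  obtain ⟨C₂, h2, hC₂⟩ := exists_norm_inv_apply_le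
    (F := fun z => z • (1 : Matrix (Fin (m + 1)) (Fin (m + 1)) ℂ) - M.Ac) (by fun_prop) (by
      intro z hz
      rcases eq_or_ne z 0 with rfl | h0
      · rw [zero_smul, zero_sub]
        exact hM.isUnit_Ac.neg
      · have h := hM.nonsingular z⁻¹ (hinv z hz)
        rw [hfac _ (inv_ne_zero h0), inv_inv] at h
        rw [Matrix.isUnit_iff_isUnit_det, Matrix.det_smul] at h
        rw [Matrix.isUnit_iff_isUnit_det]
        exact isUnit_of_mul_isUnit_right h)
  refine ⟨2 * (C₁ + C₂), by positivity, fun z hz i j => ?_⟩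
  rw [le_div_iff₀ (by positivity)]
  rcases le_total ‖z‖ 1 with hz1 | hz1
  · nlinarith [hC₁ z hz hz1 i j, norm_nonneg ((1 - z • M.Ac)⁻¹ i j), norm_nonneg z]
  · have hz0 : z ≠ 0 := norm_pos_iff.1 (zero_lt_one.trans_le hz1)
    have h3 := hC₂ z⁻¹ (hinv z hz) (by rw [norm_inv]; exact inv_le_one_of_one_le₀ hz1) i j
    have h4 : (1 - z • M.Ac)⁻¹ i j =
        z⁻¹ * (z⁻¹ • (1 : Matrix (Fin (m + 1)) (Fin (m + 1)) ℂ) - M.Ac)⁻¹ i j := by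
      have hu : IsUnit (z⁻¹ • (1 : Matrix (Fin (m + 1)) (Fin (m + 1)) ℂ) - M.Ac).det := by
        have h := hM.isUnit_det hz
        rw [hfac z hz0, Matrix.det_smul] at h
        exact isUnit_of_mul_isUnit_right h
      have h5 : (1 - z • M.Ac)⁻¹ =
          z⁻¹ • (z⁻¹ • (1 : Matrix (Fin (m + 1)) (Fin (m + 1)) ℂ) - M.Ac)⁻¹ := by
        apply Matrix.inv_eq_right_inv
        rw [hfac z hz0, Matrix.smul_mul, Matrix.mul_smul, smul_smul, mul_inv_cancel₀ hz0, one_smul,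
          Matrix.mul_nonsing_inv _ hu]
      rw [h5, Matrix.smul_apply, smul_eq_mul]
    have h6 : 0 < ‖z‖ := zero_lt_one.trans_le hz1
    rw [h4, norm_mul, norm_inv]
    calc ‖z‖⁻¹ * _ * (1 + ‖z‖) ≤ ‖z‖⁻¹ * C₂ * (2 * ‖z‖) := by gcongr; linarith
      _ = 2 * C₂ := by field_simp
      _ ≤ _ := by linarith

theorem exists_norm_q_le (hM : M.Admissible) :
    ∃ C : ℝ, 0 ≤ C ∧ ∀ z : ℂ, z.re ≤ 0 → ∀ j, ‖M.q z j‖ ≤ C / (1 + ‖z‖) := by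
  obtain ⟨C, hC, h⟩ := hM.exists_norm_resolvent_le
  refine ⟨∑ i, ‖M.bc i‖ * C, Finset.sum_nonneg fun _ _ => by positivity, fun z hz j => ?_⟩
  rw [Finset.sum_div]
  change ‖∑ i, M.bc i * (1 - z • M.Ac)⁻¹ i j‖ ≤ _
  refine (norm_sum_le _ _).trans (Finset.sum_le_sum fun i _ => ?_)
  rw [norm_mul, mul_div_assoc]
  exact mul_le_mul_of_nonneg_left (h z hz i j) (norm_nonneg _)

theorem exists_norm_r_le (hM : M.Admissible) :
    ∃ C : ℝ, 0 ≤ C ∧ ∀ z : ℂ, z.re ≤ 0 → ‖M.r z‖ ≤ C / (1 + ‖z‖) := by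
  obtain ⟨C, hC, h⟩ := hM.exists_norm_resolvent_le
  refine ⟨∑ _i : Fin (m + 1), C, Finset.sum_nonneg fun _ _ => hC, fun z hz => ?_⟩
  rw [hM.r_eq hz, Finset.sum_div]
  change ‖∑ i, (1 - z • M.Ac)⁻¹ (Fin.last m) i * 1‖ ≤ _
  refine (norm_sum_le _ _).trans (Finset.sum_le_sum fun i _ => ?_)
  simpa using h z hz (Fin.last m) i

end Admissible

theorem measurable_q_apply (M : RungeKutta m) (j : Fin (m + 1)) : Measurable fun z => M.q z j := by
  simp only [q, Matrix.vecMul, dotProduct]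
  refine Finset.measurable_fun_sum _ fun i _ => Measurable.const_mul ?_ _
  exact measurable_inv_apply (F := fun z => 1 - z • M.Ac) (by fun_prop) i j

theorem measurable_r (M : RungeKutta m) : Measurable M.r := by
  unfold r
  simp only [dotProduct, mul_one]
  exact (measurable_id.mul (Finset.measurable_fun_sum _ fun j _ => M.measurable_q_apply j)).const_add 1

end RungeKutta

/-! ### Seminorms on `ℂ^s`: the decay constant, and the triangle inequality for integrals. -/

theorem Seminorm.exists_le_mul_of_norm_apply_le {ι : Type*} [Fintype ι]
    (N : Seminorm ℂ (ι → ℂ)) :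
    ∃ C : ℝ, 0 ≤ C ∧ ∀ (v : ι → ℂ) (B : ℝ), (∀ i, ‖v i‖ ≤ B) → N v ≤ C * B := by
  classical
  refine ⟨∑ i, N (Pi.single i 1), Finset.sum_nonneg fun _ _ => apply_nonneg _ _, fun v B hv => ?_⟩
  have h : v = ∑ i, v i • Pi.single i (1 : ℂ) := pi_eq_sum_univ' v
  conv_lhs => rw [h]
  rw [Finset.sum_mul]
  refine (Finset.le_sum_of_subadditive N (map_zero N).le (map_add_le_add N) _ _).trans
    (Finset.sum_le_sum fun i _ => ?_)
  rw [map_smul_eq_mul, mul_comm]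
  exact mul_le_mul_of_nonneg_left (hv i) (apply_nonneg _ _)

theorem RungeKutta.Admissible.exists_isDecayConstant {m : ℕ} {M : RungeKutta m}
    (hM : M.Admissible) (N : Seminorm ℂ (Fin (m + 1) → ℂ)) : ∃ C : ℝ, M.IsDecayConstant N C := by
  obtain ⟨C₁, h1, hC₁⟩ := hM.exists_norm_q_le
  obtain ⟨C₂, h2, hC₂⟩ := hM.exists_norm_r_le
  obtain ⟨D, hD, hDN⟩ := N.exists_le_mul_of_norm_apply_le
  have key : ∀ (z : ℂ) (c : ℝ), 0 ≤ c → ‖z‖ * (c / (1 + ‖z‖)) ≤ c := by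
    intro z c hc
    rw [← mul_div_assoc, div_le_iff₀ (by positivity)]
    nlinarith [norm_nonneg z]
  refine ⟨C₂ + D * C₁ + 1, by positivity, fun z hz => ?_⟩
  have hDC : 0 ≤ D * C₁ := by positivity
  rw [mul_max_of_nonneg _ _ (norm_nonneg z)]
  refine max_le ?_ ?_
  · have := mul_le_mul_of_nonneg_left (hC₂ z hz) (norm_nonneg z)
    linarith [key z C₂ h2]
  · have := mul_le_mul_of_nonneg_left (hDN _ _ (hC₁ z hz)) (norm_nonneg z)
    rw [← mul_div_assoc] at this
    linarith [key z (D * C₁) hDC]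

section SeminormIntegral

variable {ι : Type*} [Fintype ι]

theorem Seminorm.continuous_pi_complex (N : Seminorm ℂ (ι → ℂ)) : Continuous N := by
  classical
  obtain ⟨C, hC, h⟩ := N.exists_le_mul_of_norm_apply_le
  refine (LipschitzWith.of_dist_le_mul (K := ⟨C, hC⟩) fun u v => ?_).continuous
  rw [Real.dist_eq, dist_eq_norm]
  exact (abs_sub_map_le_sub N u v).trans (h _ _ fun i => norm_le_pi_norm (u - v) i)

theorem Seminorm.integrable_comp {α : Type*} [MeasurableSpace α] {μ : Measure α}
    (N : Seminorm ℂ (ι → ℂ)) {v : α → ι → ℂ} (hv : Integrable v μ) :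
    Integrable (fun a => N (v a)) μ := by
  classical
  obtain ⟨C, hC, h⟩ := N.exists_le_mul_of_norm_apply_le
  refine (hv.norm.const_mul C).mono'
    (N.continuous_pi_complex.comp_aestronglyMeasurable hv.aestronglyMeasurable)
    (Eventually.of_forall fun a => ?_)
  rw [Real.norm_of_nonneg (apply_nonneg N _)]
  exact h _ _ fun i => norm_le_pi_norm (v a) i

/-- The Bochner integral refers to the sup norm, so Hahn–Banach is used: a real functional below `N`
that attains `N` at the integral commutes with the integral. -/
theorem Seminorm.map_integral_le {α : Type*} [MeasurableSpace α] {μ : Measure α}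
    (N : Seminorm ℂ (ι → ℂ)) {v : α → ι → ℂ} (hv : Integrable v μ) :
    N (∫ a, v a ∂μ) ≤ ∫ a, N (v a) ∂μ := by
  set v₀ := ∫ a, v a ∂μ with hv₀
  have hreal : ∀ (c : ℝ) (u : ι → ℂ), N (c • u) = |c| * N u := by
    intro c u
    rw [← Complex.coe_smul, map_smul_eq_mul, norm_real, Real.norm_eq_abs]
  rcases eq_or_ne v₀ 0 with h0 | h0
  · rw [h0, map_zero]
    exact integral_nonneg fun a => apply_nonneg N _
  obtain ⟨g, hg1, hg2⟩ := exists_extension_of_le_sublinear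
    (LinearPMap.mkSpanSingleton (K := ℝ) v₀ (N v₀) h0) N
    (fun c hc u => by rw [hreal, abs_of_pos hc]) (map_add_le_add N) (by
      rintro ⟨u, hu⟩
      obtain ⟨c, rfl⟩ := Submodule.mem_span_singleton.1 hu
      refine (le_of_eq (LinearPMap.mkSpanSingleton'_apply v₀ (N v₀) _ c hu)).trans ?_
      change c • N v₀ ≤ N (c • v₀)
      rw [hreal, smul_eq_mul]
      exact mul_le_mul_of_nonneg_right (le_abs_self c) (apply_nonneg N _))
  have hg0 : g v₀ = N v₀ := by
    have := hg1 ⟨v₀, Submodule.mem_span_singleton_self v₀⟩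
    exact this.trans (LinearPMap.mkSpanSingleton_apply ℝ ℝ h0 (N v₀))
  have h2 := (LinearMap.toContinuousLinearMap g).integral_comp_comm hv
  simp only [LinearMap.coe_toContinuousLinearMap'] at h2
  rw [← hg0, hv₀, ← h2]
  exact integral_mono ((LinearMap.toContinuousLinearMap g).integrable_comp hv)
    (N.integrable_comp hv) fun a => hg2 (v a)

end SeminormIntegral

/-! ### The convolution weights as contour integrals. -/

namespace RungeKutta.Admissible

variable {m : ℕ} {M : RungeKutta m}

theorem exists_norm_scaled_q_le (hM : M.Admissible) {h : ℝ} (hh : 0 < h) :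
    ∃ C : ℝ, 0 ≤ C ∧ ∀ z : ℂ, z.re ≤ 0 → ∀ j, ‖M.q (h * z) j‖ ≤ C / (1 + ‖z‖) := by
  obtain ⟨C, hC, hb⟩ := hM.exists_norm_q_le
  refine ⟨C * (1 + 1 / h), by positivity, fun z hz j => ?_⟩
  have hz' : ((h : ℂ) * z).re ≤ 0 := by
    rw [re_ofReal_mul]
    exact mul_nonpos_of_nonneg_of_nonpos hh.le hz
  refine (hb _ hz' j).trans ?_
  rw [norm_mul, norm_real, Real.norm_of_nonneg hh.le, div_le_div_iff₀ (by positivity)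
    (by positivity), mul_assoc]
  refine mul_le_mul_of_nonneg_left ?_ hC
  have h1 : (1 + 1 / h) * (1 + h * ‖z‖) = 1 + ‖z‖ + (h * ‖z‖ + 1 / h) := by field_simp; ring
  rw [h1]
  exact le_add_of_nonneg_right (by positivity)

theorem re_ofReal_mul_nonpos {h : ℝ} (hh : 0 < h) {z : ℂ} (hz : z.re ≤ 0) :
    ((h : ℂ) * z).re ≤ 0 := by
  rw [re_ofReal_mul]
  exact mul_nonpos_of_nonneg_of_nonpos hh.le hz

variable {α : Type*} [MeasurableSpace α] {μ : Measure α} {w φ : α → ℂ}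

/-- `|r| ≤ 1` and `q(hw) = O(1 / (1 + |w|))`, which is the weight in `CauchyDatum`. -/
theorem integrable_mul_pow_mul_q (hM : M.Admissible) (H : CauchyDatum μ w φ) {h : ℝ} (hh : 0 < h)
    (n : ℕ) (j : Fin (m + 1)) :
    Integrable (fun a => φ a * (M.r (h * w a) ^ n * M.q (h * w a) j)) μ := by
  obtain ⟨C, hC, hb⟩ := hM.exists_norm_scaled_q_le hh
  refine H.integrable_mul (H.aestronglyMeasurable_comp
    (g := fun z => M.r (h * z) ^ n * M.q (h * z) j) ?_) C fun a ha => ?_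
  · exact ((M.measurable_r.comp (measurable_const_mul _)).pow_const n).mul
      ((M.measurable_q_apply j).comp (measurable_const_mul _))
  · rw [norm_mul, norm_pow]
    refine (mul_le_of_le_one_left (norm_nonneg _) ?_).trans (hb _ ha j)
    exact pow_le_one₀ (norm_nonneg _) (hM.norm_r_le _ (re_ofReal_mul_nonpos hh ha))

/-- Here `(w - Δ/h)⁻¹ = -h (Δ - hw)⁻¹`, whose last row is a geometric series in `ζ r(hw)`. The terms
have integrals `O(|ζ|ⁿ)`, so sum and integral may be exchanged. -/
theorem hasSum_integral_resolvent (hM : M.Admissible) (H : CauchyDatum μ w φ) {h : ℝ} (hh : 0 < h)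
    (j : Fin (m + 1)) {ζ : ℂ} (hζ : ‖ζ‖ < 1) :
    HasSum (fun n : ℕ => (-(h : ℂ) * ∫ a, φ a * (M.r (h * w a) ^ n * M.q (h * w a) j) ∂μ) * ζ ^ n)
      (∫ a, φ a * (w a • (1 : Matrix (Fin (m + 1)) (Fin (m + 1)) ℂ) -
        (h : ℂ)⁻¹ • M.symbol ζ)⁻¹ (Fin.last m) j ∂μ) := by
  have hh0 : (h : ℂ) ≠ 0 := ofReal_ne_zero.2 hh.ne'
  obtain ⟨C, hC, hb⟩ := hM.exists_norm_scaled_q_le hh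
  have hint := fun n : ℕ => ((hM.integrable_mul_pow_mul_q H hh n j).const_mul (-(h : ℂ))).mul_const
    (ζ ^ n)
  have hbound : ∀ n : ℕ, ∫ a, ‖-(h : ℂ) * (φ a * (M.r (h * w a) ^ n * M.q (h * w a) j)) * ζ ^ n‖ ∂μ
      ≤ (h * C * ∫ a, ‖φ a‖ / (1 + ‖w a‖) ∂μ) * ‖ζ‖ ^ n := by
    intro n
    rw [← integral_const_mul, ← integral_mul_const]
    refine integral_mono_ae (hint n).norm ((H.integrable.const_mul _).mul_const _) ?_
    filter_upwards [H.re_nonpos] with a ha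
    have h1 : ‖M.r (h * w a)‖ ^ n ≤ 1 :=
      pow_le_one₀ (norm_nonneg _) (hM.norm_r_le _ (re_ofReal_mul_nonpos hh ha))
    rw [norm_mul, norm_mul, norm_neg, norm_real, Real.norm_of_nonneg hh.le, norm_mul, norm_mul,
      norm_pow, norm_pow]
    refine mul_le_mul_of_nonneg_right ?_ (by positivity)
    calc h * (‖φ a‖ * (‖M.r (h * w a)‖ ^ n * ‖M.q (h * w a) j‖)) ≤
          h * (‖φ a‖ * (1 * (C / (1 + ‖w a‖)))) := by gcongr; exact hb _ ha j
      _ = _ := by ring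
  have hsum : Summable fun n : ℕ =>
      ∫ a, ‖-(h : ℂ) * (φ a * (M.r (h * w a) ^ n * M.q (h * w a) j)) * ζ ^ n‖ ∂μ :=
    Summable.of_nonneg_of_le (fun n => integral_nonneg fun a => norm_nonneg _) hbound
      ((summable_geometric_of_lt_one (norm_nonneg ζ) hζ).mul_left _)
  have key := hasSum_integral_of_summable_integral_norm hint hsum
  have hlim : ∫ a, ∑' n : ℕ, -(h : ℂ) * (φ a * (M.r (h * w a) ^ n * M.q (h * w a) j)) * ζ ^ n ∂μ =
      ∫ a, φ a * (w a • (1 : Matrix (Fin (m + 1)) (Fin (m + 1)) ℂ) -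
        (h : ℂ)⁻¹ • M.symbol ζ)⁻¹ (Fin.last m) j ∂μ := by
    refine integral_congr_ae ?_
    filter_upwards [H.re_nonpos] with a ha
    have hz := re_ofReal_mul_nonpos hh ha
    have h1 : (w a • (1 : Matrix (Fin (m + 1)) (Fin (m + 1)) ℂ) - (h : ℂ)⁻¹ • M.symbol ζ)⁻¹ =
        (-(h : ℂ)) • (M.symbol ζ -
          ((h : ℂ) * w a) • (1 : Matrix (Fin (m + 1)) (Fin (m + 1)) ℂ))⁻¹ := by
      apply Matrix.inv_eq_right_inv
      have h2 : w a • (1 : Matrix (Fin (m + 1)) (Fin (m + 1)) ℂ) - (h : ℂ)⁻¹ • M.symbol ζ =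
          (-(h : ℂ)⁻¹) • (M.symbol ζ -
            ((h : ℂ) * w a) • (1 : Matrix (Fin (m + 1)) (Fin (m + 1)) ℂ)) := by
        rw [smul_sub, smul_smul, neg_mul, inv_mul_cancel_left₀ hh0, neg_smul, neg_smul]
        abel
      rw [h2, Matrix.smul_mul, Matrix.mul_smul, smul_smul, Matrix.mul_nonsing_inv _
        ((Matrix.isUnit_iff_isUnit_det _).1 (hM.isUnit_symbol_sub hz hζ)), neg_mul_neg,
        inv_mul_cancel₀ hh0, one_smul]
    rw [h1, Matrix.smul_apply, hM.symbol_resolvent_last hz hζ, Pi.smul_apply, smul_eq_mul,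
      smul_eq_mul]
    have h3 := ((hM.hasSum_geometric hz hζ).mul_left
      (-(h : ℂ) * φ a * M.q (h * w a) j)).tsum_eq
    rw [show φ a * (-(h : ℂ) * ((1 - ζ * M.r (h * w a))⁻¹ * M.q (h * w a) j)) =
      -(h : ℂ) * φ a * M.q (h * w a) j * (1 - ζ * M.r (h * w a))⁻¹ by ring, ← h3]
    exact tsum_congr fun n => by ring
  rw [hlim] at key
  refine key.congr_fun fun n => ?_
  rw [← integral_const_mul, ← integral_mul_const]

theorem weight_apply (hM : M.Admissible) (x : ℝ) {h ξ : ℝ} (hh : 0 < h) (hξ : 0 < ξ) (n : ℕ)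
    (j : Fin (m + 1)) : M.weight h x n j =
      -(h : ℂ) * (∫ l in Ioc 0 ξ, -(jumpFn x l) / (2 * Real.pi * I) *
        (M.r (h * -(l : ℂ)) ^ n * M.q (h * -(l : ℂ)) j)) +
      -(h : ℂ) * (∫ y in Ioi (0 : ℝ), -(transferFn x (verticalLine ξ 1 y)) / (2 * Real.pi) *
        (M.r (h * verticalLine ξ 1 y) ^ n * M.q (h * verticalLine ξ 1 y) j)) +
      -(h : ℂ) * (∫ y in Ioi (0 : ℝ), -(transferFn x (verticalLine ξ (-1) y)) / (2 * Real.pi) *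
        (M.r (h * verticalLine ξ (-1) y) ^ n * M.q (h * verticalLine ξ (-1) y) j)) := by
  have H0 := cauchyDatum_cut x ξ
  have H1 := cauchyDatum_verticalLine x hξ.le (s := 1) (Or.inl rfl)
  have H2 := cauchyDatum_verticalLine x hξ.le (s := -1) (Or.inr rfl)
  refine iteratedDeriv_div_factorial_of_hasSum (c := fun n =>
    -(h : ℂ) * (∫ l in Ioc 0 ξ, -(jumpFn x l) / (2 * Real.pi * I) *
        (M.r (h * -(l : ℂ)) ^ n * M.q (h * -(l : ℂ)) j)) +
      -(h : ℂ) * (∫ y in Ioi (0 : ℝ), -(transferFn x (verticalLine ξ 1 y)) / (2 * Real.pi) *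
        (M.r (h * verticalLine ξ 1 y) ^ n * M.q (h * verticalLine ξ 1 y) j)) +
      -(h : ℂ) * (∫ y in Ioi (0 : ℝ), -(transferFn x (verticalLine ξ (-1) y)) / (2 * Real.pi) *
        (M.r (h * verticalLine ξ (-1) y) ^ n * M.q (h * verticalLine ξ (-1) y) j)))
    (fun ζ hζ => ?_) n
  have hB := fun μ => hM.re_pos_of_isRoot hh hζ (μ := μ)
  obtain ⟨P0, hP0, e0⟩ := H0.exists_interpolant hB
  obtain ⟨P1, hP1, e1⟩ := H1.exists_interpolant hB
  obtain ⟨P2, hP2, e2⟩ := H2.exists_interpolant hB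
  have hP : InterpolatesOnSpectrum (transferFn x) ((h : ℂ)⁻¹ • M.symbol ζ) (P0 + P1 + P2) := by
    refine ((hP0.add hP1).add hP2).congr fun μ hμ => ?_
    filter_upwards [(isOpen_lt continuous_const continuous_re).mem_nhds (hB μ hμ)] with z hz
    exact (transferFn_eq_integral x hξ hz).symm
  have hv : matrixFunction (transferFn x) ((h : ℂ)⁻¹ • M.symbol ζ) (Fin.last m) j =
      Polynomial.aeval ((h : ℂ)⁻¹ • M.symbol ζ) P0 (Fin.last m) j +
      Polynomial.aeval ((h : ℂ)⁻¹ • M.symbol ζ) P1 (Fin.last m) j +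
      Polynomial.aeval ((h : ℂ)⁻¹ • M.symbol ζ) P2 (Fin.last m) j := by
    rw [hP.matrixFunction_eq, map_add, map_add]
    rfl
  change HasSum _ (matrixFunction (transferFn x) ((h : ℂ)⁻¹ • M.symbol ζ) (Fin.last m) j)
  rw [hv, e0, e1, e2]
  refine (((hM.hasSum_integral_resolvent H0 hh j hζ).add
    (hM.hasSum_integral_resolvent H1 hh j hζ)).add
    (hM.hasSum_integral_resolvent H2 hh j hζ)).congr_fun fun n => ?_
  ring

end RungeKutta.Admissible

/-! ### The numerical constant. -/

section Estimates

/-- Convexity between `Γ(1) = Γ(2) = 1` gives `Γ(7/4) ≤ 1`, and `Γ(7/4) = (3/4) Γ(3/4)`. -/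
theorem Real.Gamma_three_quarters_le : Real.Gamma (3 / 4) ≤ 4 / 3 := by
  have h1 := Real.convexOn_Gamma.2 (show (1 : ℝ) ∈ Ioi 0 by norm_num)
    (show (2 : ℝ) ∈ Ioi 0 by norm_num) (show (0 : ℝ) ≤ 1 / 4 by norm_num)
    (show (0 : ℝ) ≤ 3 / 4 by norm_num) (by norm_num)
  rw [Real.Gamma_one, Real.Gamma_two] at h1
  have h2 := Real.Gamma_add_one (show (3 / 4 : ℝ) ≠ 0 by norm_num)
  norm_num at h1 h2
  linarith

/-- The exact integral of `(ξ² + y²)^(-3/4)` would give half the constant on the right, so there is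
room for the rounder bound `3 / √ξ`. -/
theorem three_div_two_pi_le :
    3 / (2 * Real.pi) ≤ √(2 * Real.pi) / (2 * Real.Gamma (3 / 4) ^ 2) := by
  have h1 := Real.Gamma_three_quarters_le
  have h0 : 0 < Real.Gamma (3 / 4) := Real.Gamma_pos_of_pos (by norm_num)
  have h2 : 5 / 2 ≤ √(2 * Real.pi) :=
    Real.le_sqrt_of_sq_le (by linarith [Real.pi_gt_d2])
  have h3 : Real.Gamma (3 / 4) ^ 2 ≤ (4 / 3) ^ 2 := by gcongr
  rw [div_le_div_iff₀ (by positivity) (by positivity)]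
  nlinarith [Real.pi_gt_three]

/-- Split at `y = ξ` and drop `y²` on the left, `ξ²` on the right; the pieces give `1/√ξ` and
`2/√ξ`. -/
theorem integrable_and_integral_rpow_le {ξ : ℝ} (hξ : 0 < ξ) :
    IntegrableOn (fun y : ℝ => (ξ ^ 2 + y ^ 2) ^ (-(3 / 4) : ℝ)) (Ioi 0) ∧
      ∫ y in Ioi (0 : ℝ), (ξ ^ 2 + y ^ 2) ^ (-(3 / 4) : ℝ) ≤ 3 / √ξ := by
  have hm : Measurable fun y : ℝ => (ξ ^ 2 + y ^ 2) ^ (-(3 / 4) : ℝ) := by fun_prop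
  have hle : ∀ t y : ℝ, 0 < t → t ^ 2 ≤ ξ ^ 2 + y ^ 2 →
      (ξ ^ 2 + y ^ 2) ^ (-(3 / 4) : ℝ) ≤ t ^ (-(3 / 2) : ℝ) := by
    intro t y ht h
    rw [show (-(3 / 2) : ℝ) = (2 : ℕ) * (-(3 / 4)) by norm_num, Real.rpow_mul ht.le,
      Real.rpow_natCast]
    exact Real.rpow_le_rpow_of_nonpos (by positivity) h (by norm_num)
  have h1 : IntegrableOn (fun _ : ℝ => ξ ^ (-(3 / 2) : ℝ)) (Ioc 0 ξ) :=
    integrableOn_const (by simp)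
  have h2 : IntegrableOn (fun y : ℝ => y ^ (-(3 / 2) : ℝ)) (Ioi ξ) :=
    integrableOn_Ioi_rpow_of_lt (by norm_num) hξ
  have b1 : ∀ y : ℝ, (ξ ^ 2 + y ^ 2) ^ (-(3 / 4) : ℝ) ≤ ξ ^ (-(3 / 2) : ℝ) := fun y =>
    hle ξ y hξ (by nlinarith)
  have b2 : ∀ y ∈ Ioi ξ, (ξ ^ 2 + y ^ 2) ^ (-(3 / 4) : ℝ) ≤ y ^ (-(3 / 2) : ℝ) := fun y hy =>
    hle y y (hξ.trans hy) (by nlinarith)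
  have hn : ∀ y : ℝ, ‖(ξ ^ 2 + y ^ 2) ^ (-(3 / 4) : ℝ)‖ = (ξ ^ 2 + y ^ 2) ^ (-(3 / 4) : ℝ) :=
    fun y => Real.norm_of_nonneg (by positivity)
  have i1 : IntegrableOn (fun y : ℝ => (ξ ^ 2 + y ^ 2) ^ (-(3 / 4) : ℝ)) (Ioc 0 ξ) :=
    h1.mono' hm.aestronglyMeasurable (Eventually.of_forall fun y => by rw [hn]; exact b1 y)
  have i2 : IntegrableOn (fun y : ℝ => (ξ ^ 2 + y ^ 2) ^ (-(3 / 4) : ℝ)) (Ioi ξ) := by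
    refine h2.mono' hm.aestronglyMeasurable ?_
    filter_upwards [ae_restrict_mem measurableSet_Ioi] with y hy
    rw [hn]
    exact b2 y hy
  have hI : Ioc 0 ξ ∪ Ioi ξ = Ioi 0 := Ioc_union_Ioi_eq_Ioi hξ.le
  refine ⟨hI ▸ i1.union i2, ?_⟩
  have hpow : ξ ^ (-(1 / 2) : ℝ) = 1 / √ξ := by
    rw [Real.rpow_neg hξ.le, ← Real.sqrt_eq_rpow, one_div]
  have v1 : ∫ y in Ioc 0 ξ, (ξ ^ 2 + y ^ 2) ^ (-(3 / 4) : ℝ) ≤ 1 / √ξ := by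
    refine (setIntegral_mono i1 h1 b1).trans (le_of_eq ?_)
    rw [setIntegral_const, measureReal_def, Real.volume_Ioc, sub_zero,
      ENNReal.toReal_ofReal hξ.le, smul_eq_mul, ← hpow]
    nth_rewrite 1 [← Real.rpow_one ξ]
    rw [← Real.rpow_add hξ]
    norm_num
  have v2 : ∫ y in Ioi ξ, (ξ ^ 2 + y ^ 2) ^ (-(3 / 4) : ℝ) ≤ 2 / √ξ := by
    refine (setIntegral_mono_on i2 h2 measurableSet_Ioi b2).trans (le_of_eq ?_)
    rw [integral_Ioi_rpow_of_lt (by norm_num) hξ, show (-(3 / 2) + 1 : ℝ) = -(1 / 2) by norm_num,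
      hpow]
    ring
  rw [← hI, setIntegral_union (Ioc_disjoint_Ioi le_rfl) measurableSet_Ioi i1 i2]
  calc _ ≤ 1 / √ξ + 2 / √ξ := add_le_add v1 v2
    _ = 3 / √ξ := by ring

end Estimates

/-! ### The truncation error and its two bounds. -/

namespace RungeKutta.Admissible

variable {m : ℕ} {M : RungeKutta m}

theorem norm_r_le_exp_gammaInf (hM : M.Admissible) {η : ℝ} (hη : 0 < η) {z : ℂ} (hz : z.re = -η) :
    ‖M.r z‖ ≤ Real.exp (-(M.gammaInf η * η)) := by
  rcases eq_or_ne (M.r z) 0 with h0 | h0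
  · rw [h0, norm_zero]
    exact (Real.exp_pos _).le
  have hbdd : BddBelow {t : ℝ | ∃ z : ℂ, -η ≤ z.re ∧ z.re < 0 ∧ M.r z ≠ 0 ∧
      t = Real.log ‖M.r z‖ / z.re} := by
    -- `log |r|` and `Re z` are both nonpositive, so `0` is a lower bound and the infimum is a
    -- genuine one.
    refine ⟨0, ?_⟩
    rintro t ⟨w, -, hw, -, rfl⟩
    exact div_nonneg_of_nonpos (Real.log_nonpos (norm_nonneg _) (hM.norm_r_le w hw.le)) hw.le
  have h1 : M.gammaInf η ≤ Real.log ‖M.r z‖ / z.re :=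
    csInf_le hbdd ⟨z, hz.ge, by linarith, h0, rfl⟩
  rw [hz, div_neg, le_neg, div_le_iff₀ hη] at h1
  rw [← Real.log_le_iff_le_exp (norm_pos_iff.2 h0)]
  linarith

variable {h ξ : ℝ}

theorem eVec_verticalLine (hM : M.Admissible) (hh : 0 < h) (hξ : 0 < ξ) (n : ℕ) (s y : ℝ) :
    M.eVec n (h * verticalLine ξ s y) =
      M.r (h * verticalLine ξ s y) ^ n • M.q (h * verticalLine ξ s y) :=
  hM.eVec_eq n (re_ofReal_mul_nonpos hh (by rw [verticalLine_re]; linarith))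

theorem integrable_transferFn_smul_eVec (hM : M.Admissible) (hh : 0 < h) (hξ : 0 < ξ) (x : ℝ)
    (n : ℕ) {s : ℝ} (hs : s = 1 ∨ s = -1) : IntegrableOn (fun y =>
      transferFn x (verticalLine ξ s y) • M.eVec n (h * verticalLine ξ s y)) (Ioi 0) := by
  refine Integrable.of_eval fun j => ?_
  have hpi : (Real.pi : ℂ) ≠ 0 := ofReal_ne_zero.2 Real.pi_ne_zero
  refine ((hM.integrable_mul_pow_mul_q (cauchyDatum_verticalLine x hξ.le hs) hh n j).const_mul
    (-(2 * Real.pi : ℂ))).congr (Eventually.of_forall fun y => ?_)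
  simp only [hM.eVec_verticalLine hh hξ, Pi.smul_apply, smul_eq_mul]
  field_simp

theorem eVec_cut (hM : M.Admissible) (hh : 0 < h) (n : ℕ) {l : ℝ} (hl : l ∈ Ioc 0 ξ) :
    M.eVec n (-((h : ℂ) * l)) = M.r (h * -(l : ℂ)) ^ n • M.q (h * -(l : ℂ)) := by
  rw [← mul_neg]
  exact hM.eVec_eq n (re_ofReal_mul_nonpos hh (by simpa using hl.1.le))

theorem integrable_jumpFn_smul_eVec (hM : M.Admissible) (hh : 0 < h) (x : ℝ) (n : ℕ) :
    IntegrableOn (fun l : ℝ => jumpFn x l • M.eVec n (-((h : ℂ) * l))) (Ioc 0 ξ) := by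
  refine Integrable.of_eval fun j => ?_
  have hpi : (Real.pi : ℂ) ≠ 0 := ofReal_ne_zero.2 Real.pi_ne_zero
  have hI := I_ne_zero
  refine ((hM.integrable_mul_pow_mul_q (cauchyDatum_cut x ξ) hh n j).const_mul
    (-(2 * Real.pi * I : ℂ))).congr ?_
  filter_upwards [ae_restrict_mem measurableSet_Ioc] with l hl
  simp only [hM.eVec_cut hh n hl, Pi.smul_apply, smul_eq_mul]
  field_simp

/-- The integral over the cut in the formula for the weight is exactly the truncated integral, so
only the half-lines remain. -/
theorem weight_sub_truncated (hM : M.Admissible) (hh : 0 < h) (hξ : 0 < ξ) (x : ℝ) (n : ℕ) :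
    M.weight h x n - M.truncated h ξ x n = ((h : ℂ) / (2 * Real.pi)) •
      ((∫ y in Ioi (0 : ℝ),
        transferFn x (verticalLine ξ 1 y) • M.eVec n (h * verticalLine ξ 1 y)) +
      ∫ y in Ioi (0 : ℝ),
        transferFn x (verticalLine ξ (-1) y) • M.eVec n (h * verticalLine ξ (-1) y)) := by
  ext j
  have h0 := hM.integrable_jumpFn_smul_eVec (ξ := ξ) hh x n
  have h1 := hM.integrable_transferFn_smul_eVec hh hξ x n (s := 1) (Or.inl rfl)
  have h2 := hM.integrable_transferFn_smul_eVec hh hξ x n (s := -1) (Or.inr rfl)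
  rw [Pi.sub_apply, hM.weight_apply x hh hξ, truncated, Pi.smul_apply, Pi.smul_apply, Pi.add_apply,
    intervalIntegral.integral_of_le hξ.le, eval_integral fun i => h0.eval i,
    eval_integral fun i => h1.eval i, eval_integral fun i => h2.eval i]
  have e0 : ∫ l in Ioc 0 ξ, -(jumpFn x l) / (2 * Real.pi * I) *
        (M.r (h * -(l : ℂ)) ^ n * M.q (h * -(l : ℂ)) j) =
      -(2 * Real.pi * I : ℂ)⁻¹ *
        ∫ l in Ioc 0 ξ, (jumpFn x l • M.eVec n (-((h : ℂ) * l))) j := by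
    rw [← integral_const_mul]
    refine setIntegral_congr_fun measurableSet_Ioc fun l hl => ?_
    simp only [hM.eVec_cut hh n hl, Pi.smul_apply, smul_eq_mul]
    ring
  have e1 : ∀ s : ℝ, ∫ y in Ioi (0 : ℝ), -(transferFn x (verticalLine ξ s y)) / (2 * Real.pi) *
        (M.r (h * verticalLine ξ s y) ^ n * M.q (h * verticalLine ξ s y) j) =
      -(2 * Real.pi : ℂ)⁻¹ * ∫ y in Ioi (0 : ℝ),
        (transferFn x (verticalLine ξ s y) • M.eVec n (h * verticalLine ξ s y)) j := by
    intro s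
    rw [← integral_const_mul]
    congr 1
    ext y
    simp only [hM.eVec_verticalLine hh hξ, Pi.smul_apply, smul_eq_mul]
    ring
  rw [e0, e1, e1, smul_eq_mul, smul_eq_mul]
  ring

/-- The factor `2` comes from the denominator of `K` and turns the prefactor `h/(2π)` into `h/(4π)`.
-/
theorem lineIntegrand_eq (N : Seminorm ℂ (Fin (m + 1) → ℂ)) (x : ℝ) (n : ℕ) {s : ℝ}
    (hs : s = 1 ∨ s = -1) (y : ℝ) : M.lineIntegrand N h ξ x n s y =
      2 * N (transferFn x (verticalLine ξ s y) • M.eVec n (h * verticalLine ξ s y)) := by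
  have h1 : √‖verticalLine ξ s y‖ = (ξ ^ 2 + y ^ 2) ^ (1 / 4 : ℝ) := by
    rw [norm_verticalLine hs, Real.sqrt_eq_rpow, Real.sqrt_eq_rpow, ← Real.rpow_mul (by positivity)]
    norm_num
  rw [map_smul_eq_mul, norm_transferFn, h1, lineIntegrand, Real.rpow_neg (by positivity),
    ← verticalLine]
  ring

theorem integrable_lineIntegrand (hM : M.Admissible) (N : Seminorm ℂ (Fin (m + 1) → ℂ))
    (hh : 0 < h) (hξ : 0 < ξ) (x : ℝ) (n : ℕ) {s : ℝ} (hs : s = 1 ∨ s = -1) :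
    IntegrableOn (M.lineIntegrand N h ξ x n s) (Ioi 0) := by
  simp_rw [funext (lineIntegrand_eq (M := M) (h := h) (ξ := ξ) N x n hs)]
  exact (N.integrable_comp (hM.integrable_transferFn_smul_eVec hh hξ x n hs)).const_mul 2

theorem seminorm_weight_sub_truncated_le (hM : M.Admissible) (N : Seminorm ℂ (Fin (m + 1) → ℂ))
    (hh : 0 < h) (hξ : 0 < ξ) (x : ℝ) (n : ℕ) :
    N (M.weight h x n - M.truncated h ξ x n) ≤
      h / (4 * Real.pi) * (∫ y in Ioi (0 : ℝ), M.lineIntegrand N h ξ x n 1 y) +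
      h / (4 * Real.pi) * (∫ y in Ioi (0 : ℝ), M.lineIntegrand N h ξ x n (-1) y) := by
  have hpi := Real.pi_pos
  have key : ∀ s : ℝ, s = 1 ∨ s = -1 → N (∫ y in Ioi (0 : ℝ),
      transferFn x (verticalLine ξ s y) • M.eVec n (h * verticalLine ξ s y)) ≤
      1 / 2 * ∫ y in Ioi (0 : ℝ), M.lineIntegrand N h ξ x n s y := by
    intro s hs
    refine (N.map_integral_le (hM.integrable_transferFn_smul_eVec hh hξ x n hs)).trans
      (le_of_eq ?_)
    rw [← integral_const_mul]
    congr 1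
    ext y
    rw [lineIntegrand_eq N x n hs]
    ring
  have hnorm : ‖(h : ℂ) / (2 * Real.pi)‖ = h / (2 * Real.pi) := by
    rw [norm_div, norm_mul, norm_real, norm_real, Real.norm_of_nonneg hh.le,
      Real.norm_of_nonneg hpi.le, RCLike.norm_ofNat]
  rw [hM.weight_sub_truncated hh hξ, map_smul_eq_mul, hnorm]
  calc _ ≤ h / (2 * Real.pi) *
        (1 / 2 * (∫ y in Ioi (0 : ℝ), M.lineIntegrand N h ξ x n 1 y) +
          1 / 2 * ∫ y in Ioi (0 : ℝ), M.lineIntegrand N h ξ x n (-1) y) := by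
        gcongr
        exact (map_add_le_add N _ _).trans
          (add_le_add (key 1 (Or.inl rfl)) (key (-1) (Or.inr rfl)))
    _ = _ := by
        field_simp
        ring

/-- The exponent `-3/4` collects `-1/2` from the decay of `q` and `-1/4` from `K`. All of the
dependence on `n` comes from `|r|ⁿ`. -/
theorem lineIntegrand_le (hM : M.Admissible) {N : Seminorm ℂ (Fin (m + 1) → ℂ)} {C : ℝ}
    (hC : M.IsDecayConstant N C) (hh : 0 < h) (hξ : 0 < ξ) (x : ℝ) (n : ℕ) {s σ y : ℝ}
    (hs : s = 1 ∨ s = -1)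
    (hσ : σ ≤ (Complex.exp (-(Real.pi * I) / 4) * verticalLine ξ s y ^ (1 / 2 : ℂ)).re) :
    M.lineIntegrand N h ξ x n s y ≤
      C / h * Real.exp (-(M.gammaInf (h * ξ) * ((n : ℝ) * h) * ξ)) * Real.exp (-|x| * σ) *
        (ξ ^ 2 + y ^ 2) ^ (-(3 / 4) : ℝ) := by
  set w := verticalLine ξ s y with hw
  have hre : w.re = -ξ := verticalLine_re ξ s y
  have hz : ((h : ℂ) * w).re ≤ 0 := re_ofReal_mul_nonpos hh (by rw [hre]; linarith)
  have hpos : 0 < ξ ^ 2 + y ^ 2 := by positivity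
  have hwn : ‖w‖ = (ξ ^ 2 + y ^ 2) ^ (1 / 2 : ℝ) := by
    rw [hw, norm_verticalLine hs, Real.sqrt_eq_rpow]
  have hr : ‖M.r (h * w)‖ ^ n ≤ Real.exp (-(M.gammaInf (h * ξ) * ((n : ℝ) * h) * ξ)) := by
    have := hM.norm_r_le_exp_gammaInf (mul_pos hh hξ) (z := h * w)
      (by rw [re_ofReal_mul, hre]; ring)
    refine (pow_le_pow_left₀ (norm_nonneg _) this n).trans (le_of_eq ?_)
    rw [← Real.exp_nat_mul]
    congr 1
    ring
  have hq : N (M.q (h * w)) ≤ C / h * (ξ ^ 2 + y ^ 2) ^ (-(1 / 2) : ℝ) := by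
    have h1 := (mul_le_mul_of_nonneg_left (le_max_right ‖M.r (h * w)‖ (N (M.q (h * w))))
      (norm_nonneg _)).trans (hC.2 _ hz)
    rw [norm_mul, norm_real, Real.norm_of_nonneg hh.le, hwn] at h1
    have h2 : 0 < (ξ ^ 2 + y ^ 2) ^ (1 / 2 : ℝ) := Real.rpow_pos_of_pos hpos _
    rw [Real.rpow_neg hpos.le, ← div_eq_mul_inv, div_div, le_div_iff₀ (by positivity)]
    linarith
  have he : Real.exp (-|x| * (Complex.exp (-(Real.pi * I) / 4) * w ^ (1 / 2 : ℂ)).re) ≤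
      Real.exp (-|x| * σ) := by
    refine Real.exp_le_exp.2 ?_
    have := mul_le_mul_of_nonneg_left hσ (abs_nonneg x)
    linarith
  have hsplit : (ξ ^ 2 + y ^ 2) ^ (-(3 / 4) : ℝ) =
      (ξ ^ 2 + y ^ 2) ^ (-(1 / 2) : ℝ) * (ξ ^ 2 + y ^ 2) ^ (-(1 / 4) : ℝ) := by
    rw [← Real.rpow_add hpos]
    norm_num
  have hC0 : 0 < C := hC.1
  rw [lineIntegrand, ← verticalLine, ← hw, hM.eVec_eq n hz, map_smul_eq_mul, norm_pow, hsplit]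
  calc _ ≤ Real.exp (-(M.gammaInf (h * ξ) * ((n : ℝ) * h) * ξ)) *
        (C / h * (ξ ^ 2 + y ^ 2) ^ (-(1 / 2) : ℝ)) * Real.exp (-|x| * σ) *
          (ξ ^ 2 + y ^ 2) ^ (-(1 / 4) : ℝ) := by gcongr
    _ = _ := by ring

theorem integral_lineIntegrand_le (hM : M.Admissible) {N : Seminorm ℂ (Fin (m + 1) → ℂ)} {C : ℝ}
    (hC : M.IsDecayConstant N C) (hh : 0 < h) (hξ : 0 < ξ) (x : ℝ) (n : ℕ) {s σ : ℝ}
    (hs : s = 1 ∨ s = -1) (hσ : ∀ y : ℝ, 0 < y →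
      σ ≤ (Complex.exp (-(Real.pi * I) / 4) * verticalLine ξ s y ^ (1 / 2 : ℂ)).re) :
    ∫ y in Ioi (0 : ℝ), M.lineIntegrand N h ξ x n s y ≤
      C / h * Real.exp (-(M.gammaInf (h * ξ) * ((n : ℝ) * h) * ξ)) * Real.exp (-|x| * σ) *
        (3 / √ξ) := by
  obtain ⟨hi, hle⟩ := integrable_and_integral_rpow_le hξ
  have hC0 : 0 < C := hC.1
  refine (setIntegral_mono_on (hM.integrable_lineIntegrand N hh hξ x n hs) (hi.const_mul _)
    measurableSet_Ioi fun y hy => hM.lineIntegrand_le hC hh hξ x n hs (hσ y hy)).trans ?_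
  rw [integral_const_mul]
  gcongr

theorem seminorm_weight_sub_truncated_le_exp (hM : M.Admissible)
    {N : Seminorm ℂ (Fin (m + 1) → ℂ)} {C : ℝ} (hC : M.IsDecayConstant N C) (hh : 0 < h)
    (hξ : 0 < ξ) (x : ℝ) (n : ℕ) :
    N (M.weight h x n - M.truncated h ξ x n) ≤
      C * (√(2 * Real.pi / ξ) / (2 * Real.Gamma (3 / 4) ^ 2)) * Real.cosh (|x| * √(ξ / 2)) *
        Real.exp (-(M.gammaInf (h * ξ) * ((n : ℝ) * h) * ξ)) := by
  have hC0 : 0 < C := hC.1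
  have hpi := Real.pi_pos
  have h1 := hM.integral_lineIntegrand_le hC hh hξ x n (s := 1) (σ := √(ξ / 2)) (Or.inl rfl)
    fun y hy => sqrt_le_re_sqrt (verticalLine_re ξ 1 y) (by rw [verticalLine_im]; linarith)
  have h2 := hM.integral_lineIntegrand_le hC hh hξ x n (s := -1) (σ := -√(ξ / 2)) (Or.inr rfl)
    fun y hy => neg_sqrt_le_re_sqrt hξ.le (verticalLine_re ξ (-1) y).ge
  have hsq : 0 < √ξ := Real.sqrt_pos.2 hξ
  have h3 : 3 / (2 * Real.pi) / √ξ ≤ √(2 * Real.pi / ξ) / (2 * Real.Gamma (3 / 4) ^ 2) := by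
    rw [Real.sqrt_div' _ hξ.le, div_right_comm (√(2 * Real.pi))]
    exact div_le_div_of_nonneg_right three_div_two_pi_le hsq.le
  set E := Real.exp (-(M.gammaInf (h * ξ) * ((n : ℝ) * h) * ξ)) with hE
  have hE0 : 0 < E := Real.exp_pos _
  have hch : 0 < Real.cosh (|x| * √(ξ / 2)) := Real.cosh_pos _
  calc _ ≤ h / (4 * Real.pi) * (C / h * E * Real.exp (-|x| * √(ξ / 2)) * (3 / √ξ)) +
        h / (4 * Real.pi) * (C / h * E * Real.exp (-|x| * -√(ξ / 2)) * (3 / √ξ)) := by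
        refine (hM.seminorm_weight_sub_truncated_le N hh hξ x n).trans ?_
        gcongr
    -- The upper half-line decays in `d` and the lower one grows; the two exponentials sum to `2
    -- cosh`, and the powers of `h` cancel.
    _ = C * (3 / (2 * Real.pi) / √ξ) * Real.cosh (|x| * √(ξ / 2)) * E := by
        rw [Real.cosh_eq, neg_mul_neg, neg_mul]
        field_simp
        ring
    _ ≤ _ := by gcongr

end RungeKutta.Admissible

end

theorem proposition4p1 {m : ℕ} (M : RungeKutta m) (hM : M.Admissible)
    (N : Seminorm ℂ (Fin (m + 1) → ℂ)) (hN : ∀ v, N v = 0 → v = 0) :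
    (∃ C : ℝ, M.IsDecayConstant N C) ∧
    ∀ (h ξ x : ℝ) (n : ℕ), 0 < h → 0 < ξ →
      IntervalIntegrable (fun l : ℝ => jumpFn x l • M.eVec n (-((h : ℂ) * (l : ℂ)))) volume 0 ξ ∧
      IntegrableOn (M.lineIntegrand N h ξ x n 1) (Ioi 0) ∧
      IntegrableOn (M.lineIntegrand N h ξ x n (-1)) (Ioi 0) ∧
      N (M.weight h x n - M.truncated h ξ x n) ≤
        h / (4 * Real.pi) * (∫ y in Ioi (0 : ℝ), M.lineIntegrand N h ξ x n 1 y) +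
        h / (4 * Real.pi) * (∫ y in Ioi (0 : ℝ), M.lineIntegrand N h ξ x n (-1) y) ∧
      ∀ C : ℝ, M.IsDecayConstant N C →
        N (M.weight h x n - M.truncated h ξ x n) ≤
          C * (Real.sqrt (2 * Real.pi / ξ) / (2 * Real.Gamma (3 / 4) ^ 2)) *
            Real.cosh (|x| * Real.sqrt (ξ / 2)) *
            Real.exp (-(M.gammaInf (h * ξ) * ((n : ℝ) * h) * ξ)) :=
  ⟨hM.exists_isDecayConstant N, fun _ _ x n hh hξ =>
    ⟨(intervalIntegrable_iff_integrableOn_Ioc_of_le hξ.le).2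
      (hM.integrable_jumpFn_smul_eVec hh x n),
    hM.integrable_lineIntegrand N hh hξ x n (Or.inl rfl),
    hM.integrable_lineIntegrand N hh hξ x n (Or.inr rfl),
    hM.seminorm_weight_sub_truncated_le N hh hξ x n,
    fun _ hC => hM.seminorm_weight_sub_truncated_le_exp hC hh hξ x n⟩⟩
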